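/- **Theorem (Convergence of ADMM for Fisher markets with homogeneous linear constraints).** Consider a Fisher market with $n$ agents and $m$ goods with capacities $\bar s\in\mathbb R^m$. Agent $i$ has a budget $w_i>0$, a utility $u_i:\mathbb R^m_{\ge 0}\to\mathbb R$ that is concave and homogeneous of degree one, and finitely many homogeneous linear constraints; let $\mathcal X_i=\{x\in\mathbb R^m_{\ge0}: A^{(i)}x\le 0\}$ and assume that $u_i(x)>0$ for some $x\in\mathcal X_i$. A price vector $p\in\mathbb R^m$ (of any sign) with an allocation $(x_i)$ is a market equilibrium if each $x_i$ maximizes $u_i$ over $\{x\in\mathcal X_i: p^Tx\le w_i\}$, $\sum_i x_{ij}=\bar s_j$ for all $j$, and $p^Tx_i=w_i$ for all $i$; then $p$ is an equilibrium price vector. Assume that a market equilibrium exists. Fix any step $\beta>0$ (chosen without regard to the utilities), a price vector $p^{(0)}\in\mathbb R^m$ and a baseline demand $y^{(0)}\in\mathbb R^{n\times m}$. For $k=0,1,2,\dots$ the algorithm computes $$x_i^{(k+1)}=\arg\max_{x_i\in\mathcal X_i}\Big\{w_i\log u_i(x_i)-\sum_j p_j^{(k)}x_{ij}-\tfrac\beta2\sum_j\big(x_{ij}-y_{ij}^{(k)}\big)^2\Big\}\quad\text{for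 all }i,$$ $$y^{(k+1)}=\arg\max_{y\in\mathbb R^{n\times m}}\Big\{-\tfrac\beta2\sum_{i,j}\big(x_{ij}^{(k+1)}-y_{ij}\big)^2-\tfrac\beta2\sum_j\Big(\sum_i y_{ij}-\bar s_j\Big)^2\Big\},$$ $$p^{(k+1)}=p^{(k)}+\beta\Big(\sum_i y_i^{(k+1)}-\bar s\Big),$$ with $\log u=-\infty$ for $u\le 0$. Write $f(x)=\sum_i w_i\log u_i(x_i)$ and $\mathcal L(x,p)=f(x)-\sum_j p_j\big(\sum_i x_{ij}-\bar s_j\big)$, and let $\bar x^K,\bar y^K,\bar p^K$ be the means of the first $K$ iterates $x^{(k)},y^{(k)},p^{(k)}$, $1\le k\le K$. If the $u_i$ are continuous, then all the maximizers above exist and are unique. In any case, for every run of the algorithm there is a market equilibrium $(p^*,x^*)$, with $(x,y)=(x^*,x^*)$ an optimal solution of the problem of maximizing $f(x)$ subject to $x_i\in\mathcal X_i$, $\sum_i y_{ij}=\bar s_j$, $y_i=x_i$, such that $p^{(k)}\to p^*$, with rate $O(1/k)$ in the sense of the alternating direction method of multipliers: 1. there is $C$ such that for all $K\ge1$, all $i$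 and all $j$: $|f(\bar x^K)-f(x^*)|\le C/K$, $|\sum_i\bar y^K_{ij}-\bar s_j|\le C/K$ and $|\bar x^K_{ij}-\bar y^K_{ij}|\le C/K$; 2. for every $R$ there is $C$ such that for all $K\ge1$, all $z$ with $z_i\in\mathcal X_i$, $u_i(z_i)>0$, $|z_{ij}|\le R$ and all $r\in\mathbb R^m$ with $|r_j|\le R$: $\mathcal L(z,\bar p^K)-\mathcal L(\bar x^K,r)\le C/K$; 3. there is $C$ such that $\|p^{(k+1)}-p^{(k)}\|_2^2\le C/k$ for all $k\ge1$. -/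

import Mathlib

open Filter Topology

noncomputable section

/-- A Fisher market with `n` agents and `m` divisible goods. Agent `i` has a budget, a utility
function on bundles, and additional linear constraints `conMat i *ᵥ x ≤ conRhs i`. -/
structure FisherMarket (n m : ℕ) where
  budget : Fin n → ℝ
  capacity : Fin m → ℝ
  utility : Fin n → (Fin m → ℝ) → ℝ
  numCon : Fin n → ℕ
  conMat : (i : Fin n) → Matrix (Fin (numCon i)) (Fin m) ℝ
  conRhs : (i : Fin n) → Fin (numCon i) → ℝ

/-- The nonnegative bundles. -/
def nonnegOrthant (m : ℕ) : Set (Fin m → ℝ) := {x | ∀ j, 0 ≤ x j}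

/-- Homogeneity of degree one on the nonnegative orthant. -/
def IsHomogeneousDegreeOne {m : ℕ} (u : (Fin m → ℝ) → ℝ) : Prop :=
  ∀ x ∈ nonnegOrthant m, ∀ t : ℝ, 0 < t → u (t • x) = t * u x

/-- The mean of the first `K` iterates `z 1, …, z K`. -/
def iterateMean {E : Type*} [AddCommGroup E] [Module ℝ E] (z : ℕ → E) (K : ℕ) : E :=
  (K : ℝ)⁻¹ • ∑ k ∈ Finset.range K, z (k + 1)

namespace FisherMarket

variable {n m : ℕ} (M : FisherMarket n m)

/-- All additional linear constraints are homogeneous. -/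
def HasHomogeneousConstraints : Prop := ∀ i t, M.conRhs i t = 0

/-- The nonnegative bundles that satisfy the additional linear constraints of agent `i`. -/
def admissible (i : Fin n) : Set (Fin m → ℝ) :=
  {x | x ∈ nonnegOrthant m ∧ ∀ t, ∑ j, M.conMat i t j * x j ≤ M.conRhs i t}

/-- `x` solves the individual optimization problem of agent `i` at the prices `p`. -/
def IsOptimalBundle (i : Fin n) (p x : Fin m → ℝ) : Prop :=
  (x ∈ M.admissible i ∧ ∑ j, p j * x j ≤ M.budget i) ∧
    ∀ z ∈ M.admissible i, ∑ j, p j * z j ≤ M.budget i → M.utility i z ≤ M.utility i x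

/-- Market equilibrium: every agent receives an optimal bundle, all goods are sold, and all
budgets are completely used. -/
def IsEquilibrium (p : Fin m → ℝ) (x : Fin n → Fin m → ℝ) : Prop :=
  (∀ i, M.IsOptimalBundle i p (x i)) ∧
  (∀ j, ∑ i, x i j = M.capacity j) ∧
  (∀ i, ∑ j, p j * x i j = M.budget i)

def IsEquilibriumPrice (p : Fin m → ℝ) : Prop := ∃ x, M.IsEquilibrium p x

/-- The admissible bundles of agent `i` at which `log (u_i x)` is finite. Bundles with
`u_i x ≤ 0` have the value `-∞` and never compete in a maximization. -/
def logDomain (i : Fin n) : Set (Fin m → ℝ) := {x | x ∈ M.admissible i ∧ 0 < M.utility i x}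

/-- The social objective `∑ i, w_i log (u_i (x_i))`. -/
def socialObjective (x : Fin n → Fin m → ℝ) : ℝ :=
  ∑ i, M.budget i * Real.log (M.utility i (x i))

/-- `(x, y)` is an optimal solution of the two-block social problem: maximize
`∑ i, w_i log (u_i (x_i))` over admissible `x_i` and free `y_i`, subject to the capacity
constraints `∑ i, y_i = s` and the coupling constraints `y_i = x_i`. -/
def IsSocialOptimum (x y : Fin n → Fin m → ℝ) : Prop :=
  ((∀ i, x i ∈ M.logDomain i) ∧ (∀ j, ∑ i, y i j = M.capacity j) ∧ y = x) ∧
    ∀ x' y' : Fin n → Fin m → ℝ,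
      ((∀ i, x' i ∈ M.logDomain i) ∧ (∀ j, ∑ i, y' i j = M.capacity j) ∧ y' = x') →
        M.socialObjective x' ≤ M.socialObjective x

/-- The Lagrangian of the social problem, prices being the multipliers of the capacity
constraints. -/
def lagrangian (x : Fin n → Fin m → ℝ) (p : Fin m → ℝ) : ℝ :=
  M.socialObjective x - ∑ j, p j * (∑ i, x i j - M.capacity j)

/-- One round of the algorithm with step size `β`, from baseline demand `y` and prices `p`
to demand `x'`, baseline demand `y'` and prices `p'`. -/
def IsADMMStep (β : ℝ) (y : Fin n → Fin m → ℝ) (p : Fin m → ℝ)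
    (x' y' : Fin n → Fin m → ℝ) (p' : Fin m → ℝ) : Prop :=
  (∀ i, x' i ∈ M.logDomain i ∧
    IsMaxOn (fun ξ : Fin m → ℝ => M.budget i * Real.log (M.utility i ξ) - ∑ j, p j * ξ j
      - β / 2 * ∑ j, (ξ j - y i j) ^ 2) (M.logDomain i) (x' i)) ∧
  IsMaxOn (fun η : Fin n → Fin m → ℝ => -(β / 2 * ∑ i, ∑ j, (x' i j - η i j) ^ 2)
      - β / 2 * ∑ j, (∑ i, η i j - M.capacity j) ^ 2) Set.univ y' ∧
  ∀ j, p' j = p j + β * (∑ i, y' i j - M.capacity j)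

/-- The sequences `x 1, x 2, …`, `y 0, y 1, …`, `p 0, p 1, …` are produced by the algorithm from
the initial data `y 0`, `p 0`. The value `x 0` plays no role. -/
def IsADMMRun (β : ℝ) (x y : ℕ → Fin n → Fin m → ℝ) (p : ℕ → Fin m → ℝ) : Prop :=
  ∀ k, M.IsADMMStep β (y k) (p k) (x (k + 1)) (y (k + 1)) (p (k + 1))

end FisherMarket

end

namespace FisherMarket

variable {n m : ℕ} {M : FisherMarket n m}

/-! ### Admissible bundles and the logarithmic domain -/

/-! Equilibria are exactly the saddle points of the Lagrangian of the social problem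
(`IsEquilibrium.isSaddlePoint`, `IsSaddlePoint.isEquilibrium`). Homogeneity is what makes this work:
bundles can be rescaled to cost exactly the budget, and stationarity along the ray through an
optimal bundle forces its cost to equal the budget. It remains to show that the algorithm finds a
saddle point.

The baseline step has a closed form, in which the residual `x' i j - y' i j` equals the excess of
`y'` for every agent. Hence the single price vector is the multiplier of all `n` coupling
constraints and of the capacity constraint, which explains the weight `n + 1` in `energyForm`. The
first-order condition of the demand step and a polarization identity give
`IsADMMStep.lagrangian_gap`: the Lagrangian gap against any reference point is at most the loss of
energy minus the movement.

Everything else follows from this inequality. At a saddle point the gap is nonnegative, so the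
energy decreases and the movements are summable; they are also nonincreasing
(`IsADMMStep.movement_le`), hence `O(1/k)`. Summed over the rounds, the inequality and Jensen give
the rates for the means. For the prices, boundedness yields limit points, each of which supports the
same allocation; convergence of the energies relative to two of them forces the two to coincide. No
limit of the allocations is taken, so the utilities need not be continuous there. Continuity enters
only in the existence of the demands. -/

lemma convex_nonnegOrthant (m : ℕ) : Convex ℝ (nonnegOrthant m) := by
  intro x hx y hy a b ha hb _ j
  have := hx j
  have := hy j
  simp only [Pi.add_apply, Pi.smul_apply, smul_eq_mul]
  positivity

lemma convex_admissible (M : FisherMarket n m) (i : Fin n) : Convex ℝ (M.admissible i) := by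
  intro x hx y hy a b ha hb hab
  refine ⟨convex_nonnegOrthant m hx.1 hy.1 ha hb hab, fun t => ?_⟩
  calc ∑ j, M.conMat i t j * (a • x + b • y) j
      = a * ∑ j, M.conMat i t j * x j + b * ∑ j, M.conMat i t j * y j := by
        rw [Finset.mul_sum, Finset.mul_sum, ← Finset.sum_add_distrib]
        exact Finset.sum_congr rfl fun j _ => by
          simp only [Pi.add_apply, Pi.smul_apply, smul_eq_mul]; ring
    _ ≤ a * M.conRhs i t + b * M.conRhs i t :=
        add_le_add (mul_le_mul_of_nonneg_left (hx.2 t) ha) (mul_le_mul_of_nonneg_left (hy.2 t) hb)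
    _ = M.conRhs i t := by rw [← add_mul, hab, one_mul]

lemma isClosed_admissible (M : FisherMarket n m) (i : Fin n) : IsClosed (M.admissible i) := by
  have h : M.admissible i = (⋂ j, {x | 0 ≤ x j}) ∩
      ⋂ t, {x | ∑ j, M.conMat i t j * x j ≤ M.conRhs i t} := by
    ext x; simp [admissible, nonnegOrthant]
  rw [h]
  refine (isClosed_iInter fun j => isClosed_le (by fun_prop) (by fun_prop)).inter
    (isClosed_iInter fun t => isClosed_le (by fun_prop) (by fun_prop))

lemma smul_mem_admissible (hhom : M.HasHomogeneousConstraints) {i : Fin n} {x : Fin m → ℝ}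
    (hx : x ∈ M.admissible i) {t : ℝ} (ht : 0 < t) : t • x ∈ M.admissible i := by
  refine ⟨fun j => mul_nonneg ht.le (hx.1 j), fun l => ?_⟩
  have h := hx.2 l
  rw [hhom] at h ⊢
  calc ∑ j, M.conMat i l j * (t • x) j = t * ∑ j, M.conMat i l j * x j := by
        rw [Finset.mul_sum]
        exact Finset.sum_congr rfl fun j _ => by simp only [Pi.smul_apply, smul_eq_mul]; ring
    _ ≤ 0 := mul_nonpos_of_nonneg_of_nonpos ht.le h

lemma smul_mem_logDomain (hhom : M.HasHomogeneousConstraints)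
    (hdeg : ∀ i, IsHomogeneousDegreeOne (M.utility i)) {i : Fin n} {x : Fin m → ℝ}
    (hx : x ∈ M.logDomain i) {t : ℝ} (ht : 0 < t) : t • x ∈ M.logDomain i := by
  refine ⟨smul_mem_admissible hhom hx.1 ht, ?_⟩
  rw [hdeg i x hx.1.1 t ht]
  exact mul_pos ht hx.2

lemma convex_logDomain (hconc : ∀ i, ConcaveOn ℝ (nonnegOrthant m) (M.utility i)) (i : Fin n) :
    Convex ℝ (M.logDomain i) := by
  intro x hx y hy a b ha hb hab
  refine ⟨M.convex_admissible i hx.1 hy.1 ha hb hab, ?_⟩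
  refine lt_of_lt_of_le ?_ ((hconc i).2 hx.1.1 hy.1.1 ha hb hab)
  exact (convex_Ioi (0 : ℝ)) hx.2 hy.2 ha hb hab

lemma concaveOn_budget_mul_log (hw : ∀ i, 0 < M.budget i)
    (hconc : ∀ i, ConcaveOn ℝ (nonnegOrthant m) (M.utility i)) (i : Fin n) :
    ConcaveOn ℝ (M.logDomain i) fun ξ => M.budget i * Real.log (M.utility i ξ) := by
  refine ⟨convex_logDomain hconc i, fun x hx y hy a b ha hb hab => ?_⟩
  have h1 := strictConcaveOn_log_Ioi.concaveOn.2 hx.2 hy.2 ha hb hab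
  have h2 : Real.log (a • M.utility i x + b • M.utility i y)
      ≤ Real.log (M.utility i (a • x + b • y)) :=
    Real.log_le_log ((convex_Ioi (0 : ℝ)) hx.2 hy.2 ha hb hab)
      ((hconc i).2 hx.1.1 hy.1.1 ha hb hab)
  have h3 := mul_le_mul_of_nonneg_left (h1.trans h2) (hw i).le
  simp only [smul_eq_mul] at h3 ⊢
  linarith

lemma concaveOn_socialObjective (hw : ∀ i, 0 < M.budget i)
    (hconc : ∀ i, ConcaveOn ℝ (nonnegOrthant m) (M.utility i)) :
    ConcaveOn ℝ {x | ∀ i, x i ∈ M.logDomain i} M.socialObjective := by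
  refine ⟨fun x hx y hy a b ha hb hab i => convex_logDomain hconc i (hx i) (hy i) ha hb hab,
    fun x hx y hy a b ha hb hab => ?_⟩
  simp only [socialObjective, Finset.smul_sum]
  rw [← Finset.sum_add_distrib]
  exact Finset.sum_le_sum fun i _ =>
    (concaveOn_budget_mul_log hw hconc i).2 (hx i) (hy i) ha hb hab

/-! ### One round of the algorithm -/

/-- The first-order optimality condition of a proximal step for a concave function. -/
lemma variational_of_isMaxOn {φ : (Fin m → ℝ) → ℝ} {S : Set (Fin m → ℝ)} (hφ : ConcaveOn ℝ S φ)
    {p y x : Fin m → ℝ} {β : ℝ} (hx : x ∈ S)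
    (hmax : IsMaxOn (fun ξ => φ ξ - ∑ j, p j * ξ j - β / 2 * ∑ j, (ξ j - y j) ^ 2) S x)
    {z : Fin m → ℝ} (hz : z ∈ S) :
    φ z - φ x ≤ ∑ j, (p j + β * (x j - y j)) * (z j - x j) := by
  set G := ∑ j, (p j + β * (x j - y j)) * (z j - x j) with hG
  set Q := β / 2 * ∑ j, (z j - x j) ^ 2 with hQ
  -- Comparison of `x` with the point `(1 - t) x + t z` of the segment: the quadratic penalty
  -- contributes only `t ^ 2 * Q`, which vanishes after division by `t` as `t → 0`.
  have key : ∀ t : ℝ, 0 < t → t ≤ 1 → φ z - φ x ≤ G + t * Q := by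
    intro t ht ht1
    have h1 := hφ.2 hx hz (sub_nonneg.2 ht1) ht.le (sub_add_cancel 1 t)
    have h2 := hmax (hφ.1 hx hz (sub_nonneg.2 ht1) ht.le (sub_add_cancel 1 t))
    simp only [smul_eq_mul, Set.mem_ofPred_eq, Pi.add_apply, Pi.smul_apply] at h1 h2
    have h3 : (∑ j, p j * ((1 - t) * x j + t * z j)
        + β / 2 * ∑ j, ((1 - t) * x j + t * z j - y j) ^ 2)
        = (∑ j, p j * x j + β / 2 * ∑ j, (x j - y j) ^ 2) + t * (G + t * Q) := by
      simp only [hG, hQ, Finset.mul_sum, ← Finset.sum_add_distrib]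
      exact Finset.sum_congr rfl fun j _ => by ring
    have h4 : t * (φ z - φ x) ≤ t * (G + t * Q) := by linarith
    exact le_of_mul_le_mul_left h4 ht
  have hlim : Tendsto (fun t : ℝ => G + t * Q) (𝓝[>] 0) (𝓝 (G + 0 * Q)) :=
    (Continuous.tendsto (by fun_prop) 0).mono_left nhdsWithin_le_nhds
  rw [zero_mul, add_zero] at hlim
  refine ge_of_tendsto hlim ?_
  filter_upwards [Ioc_mem_nhdsGT (zero_lt_one' ℝ)] with t ht using key t ht.1 ht.2

/-- Aggregate baseline demand minus capacity. -/
def excess (M : FisherMarket n m) (y : Fin n → Fin m → ℝ) (j : Fin m) : ℝ :=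
  ∑ i, y i j - M.capacity j

/-- The maximizer of the baseline-demand step. -/
noncomputable def baselineStep (M : FisherMarket n m) (x : Fin n → Fin m → ℝ) (i : Fin n) (j : Fin m) : ℝ :=
  x i j - M.excess x j / (n + 1)

lemma excess_baselineStep (x : Fin n → Fin m → ℝ) (j : Fin m) :
    M.excess (M.baselineStep x) j = M.excess x j / (n + 1) := by
  have hn : (n : ℝ) + 1 ≠ 0 := by positivity
  simp only [excess, baselineStep, Finset.sum_sub_distrib, Finset.sum_const, Finset.card_univ,
    Fintype.card_fin, nsmul_eq_mul]
  field_simp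
  ring

/-- Completion of the square. At the baseline step each residual `x i j - baselineStep x i j` equals
the excess there, so the cross terms of the two penalties cancel. -/
lemma baseline_penalty_eq (x η : Fin n → Fin m → ℝ) :
    ∑ i, ∑ j, (x i j - η i j) ^ 2 + ∑ j, (M.excess η j) ^ 2
      = (∑ i, ∑ j, (x i j - M.baselineStep x i j) ^ 2
          + ∑ j, (M.excess (M.baselineStep x) j) ^ 2)
        + (∑ i, ∑ j, (η i j - M.baselineStep x i j) ^ 2
          + ∑ j, (M.excess η j - M.excess (M.baselineStep x) j) ^ 2) := by
  have h0 : ∀ j, ∑ i, (η i j - M.baselineStep x i j)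
      = M.excess η j - M.excess (M.baselineStep x) j := fun j => by
    simp only [excess, Finset.sum_sub_distrib]; ring
  have h1 : ∀ j, ∑ i, (x i j - η i j) ^ 2
      = ∑ i, (x i j - M.baselineStep x i j) ^ 2 + ∑ i, (η i j - M.baselineStep x i j) ^ 2
        - 2 * M.excess (M.baselineStep x) j *
          (M.excess η j - M.excess (M.baselineStep x) j) := fun j => by
    rw [← h0, Finset.mul_sum, ← Finset.sum_add_distrib, ← Finset.sum_sub_distrib]
    refine Finset.sum_congr rfl fun i _ => ?_
    rw [excess_baselineStep]
    simp only [baselineStep]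
    ring
  rw [Finset.sum_comm, Finset.sum_congr rfl fun j _ => h1 j,
    Finset.sum_comm (f := fun i j => (x i j - M.baselineStep x i j) ^ 2),
    Finset.sum_comm (f := fun i j => (η i j - M.baselineStep x i j) ^ 2)]
  rw [← Finset.sum_add_distrib, ← Finset.sum_add_distrib, ← Finset.sum_add_distrib,
    ← Finset.sum_add_distrib]
  exact Finset.sum_congr rfl fun j _ => by ring

lemma isMaxOn_baseline_iff {β : ℝ} (hβ : 0 < β) (x y : Fin n → Fin m → ℝ) :
    IsMaxOn (fun η : Fin n → Fin m → ℝ => -(β / 2 * ∑ i, ∑ j, (x i j - η i j) ^ 2)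
      - β / 2 * ∑ j, (∑ i, η i j - M.capacity j) ^ 2) Set.univ y ↔ y = M.baselineStep x := by
  have hval : ∀ η : Fin n → Fin m → ℝ, -(β / 2 * ∑ i, ∑ j, (x i j - η i j) ^ 2)
      - β / 2 * ∑ j, (∑ i, η i j - M.capacity j) ^ 2
      = -(β / 2) * (∑ i, ∑ j, (x i j - η i j) ^ 2 + ∑ j, (M.excess η j) ^ 2) := fun η => by
    simp only [excess]; ring
  simp only [hval]
  constructor
  · intro h
    have h1 := h (Set.mem_univ (M.baselineStep x))
    simp only [Set.mem_ofPred_eq] at h1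
    rw [baseline_penalty_eq x y] at h1
    have h2 : 0 ≤ ∑ j, (M.excess y j - M.excess (M.baselineStep x) j) ^ 2 := by positivity
    have h3 : ∑ i, ∑ j, (y i j - M.baselineStep x i j) ^ 2 ≤ 0 := by
      by_contra hcon
      push Not at hcon
      have := mul_pos (half_pos hβ) (add_pos_of_pos_of_nonneg hcon h2)
      linarith
    have h4 := le_antisymm h3 (by positivity)
    rw [Finset.sum_eq_zero_iff_of_nonneg (fun i _ => by positivity)] at h4
    funext i j
    have h5 := h4 i (Finset.mem_univ i)
    rw [Finset.sum_eq_zero_iff_of_nonneg (fun j _ => by positivity)] at h5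
    exact sub_eq_zero.1 (pow_eq_zero_iff two_ne_zero |>.1 (h5 j (Finset.mem_univ j)))
  · rintro rfl η -
    simp only [Set.mem_ofPred_eq]
    rw [baseline_penalty_eq x η]
    have h : 0 ≤ β / 2 * (∑ i, ∑ j, (η i j - M.baselineStep x i j) ^ 2
        + ∑ j, (M.excess η j - M.excess (M.baselineStep x) j) ^ 2) := by positivity
    linarith

namespace IsADMMStep

variable {β : ℝ} {y x' y' : Fin n → Fin m → ℝ} {p p' : Fin m → ℝ}

lemma price_eq (h : M.IsADMMStep β y p x' y' p') (j : Fin m) :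
    p' j = p j + β * M.excess y' j := h.2.2 j

/-- Stationarity of the baseline step. The residual does not depend on the agent, so no separate
multipliers for the coupling constraints are needed. -/
lemma demand_eq (hβ : 0 < β) (h : M.IsADMMStep β y p x' y' p') (i : Fin n) (j : Fin m) :
    x' i j = y' i j + M.excess y' j := by
  obtain rfl := (isMaxOn_baseline_iff hβ x' y').1 h.2.1
  rw [excess_baselineStep, baselineStep]
  ring

lemma excess_demand (hβ : 0 < β) (h : M.IsADMMStep β y p x' y' p') (j : Fin m) :
    ∑ i, x' i j - M.capacity j = (n + 1) * M.excess y' j := by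
  have h1 : M.excess y' j = M.excess x' j / (n + 1) := by
    rw [(isMaxOn_baseline_iff hβ x' y').1 h.2.1, excess_baselineStep]
  have hn : (n : ℝ) + 1 ≠ 0 := by positivity
  rw [h1, mul_div_cancel₀ _ hn, excess]

lemma mem_logDomain (h : M.IsADMMStep β y p x' y' p') (i : Fin n) : x' i ∈ M.logDomain i :=
  (h.1 i).1

/-- The gradient of the proximal step, `p + β (x' - y)`, becomes `p' + β (y' - y)` once the demand
and the old price are eliminated. -/
lemma variational (hw : ∀ i, 0 < M.budget i)
    (hconc : ∀ i, ConcaveOn ℝ (nonnegOrthant m) (M.utility i)) (hβ : 0 < β)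
    (h : M.IsADMMStep β y p x' y' p') {z : Fin n → Fin m → ℝ} (hz : ∀ i, z i ∈ M.logDomain i) :
    M.socialObjective z - M.socialObjective x'
      ≤ ∑ j, ∑ i, (p' j + β * (y' i j - y i j)) * (z i j - x' i j) := by
  rw [Finset.sum_comm, socialObjective, socialObjective, ← Finset.sum_sub_distrib]
  refine Finset.sum_le_sum fun i _ => ?_
  refine (variational_of_isMaxOn (concaveOn_budget_mul_log hw hconc i) (h.1 i).1 (h.1 i).2
    (hz i)).trans_eq (Finset.sum_congr rfl fun j _ => ?_)
  rw [h.demand_eq hβ i j, h.price_eq j]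
  ring

end IsADMMStep

/-! ### The energy estimate -/

/-- The quadratic form of the energy: prices, baseline demand and excess demand. -/
noncomputable def energyForm (β : ℝ) (q : Fin m → ℝ) (v : Fin n → Fin m → ℝ) (e : Fin m → ℝ) : ℝ :=
  ∑ j, ((n + 1) / (2 * β) * q j ^ 2 + β / 2 * ∑ i, v i j ^ 2 + β / 2 * e j ^ 2)

/-- The energy of baseline demand `y` and prices `p` relative to the reference point `(z, r)`. -/
noncomputable def energy (M : FisherMarket n m) (β : ℝ) (y : Fin n → Fin m → ℝ) (p : Fin m → ℝ)
    (z : Fin n → Fin m → ℝ) (r : Fin m → ℝ) : ℝ :=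
  energyForm β (fun j => r j - p j) (fun i j => z i j - y i j) (M.excess y)

/-- The energy of the change from `(y, p)` to `(y', p')`. -/
noncomputable def movement (M : FisherMarket n m) (β : ℝ) (y : Fin n → Fin m → ℝ) (p : Fin m → ℝ)
    (y' : Fin n → Fin m → ℝ) (p' : Fin m → ℝ) : ℝ :=
  energyForm β (fun j => p' j - p j) (fun i j => y' i j - y i j)
    (fun j => M.excess y' j - M.excess y j)

lemma energyForm_nonneg {β : ℝ} (hβ : 0 < β) (q : Fin m → ℝ) (v : Fin n → Fin m → ℝ)
    (e : Fin m → ℝ) : 0 ≤ energyForm β q v e :=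
  Finset.sum_nonneg fun j _ => by positivity

lemma sum_sq_le_energyForm {β : ℝ} (hβ : 0 < β) (q : Fin m → ℝ) (v : Fin n → Fin m → ℝ)
    (e : Fin m → ℝ) : ∑ j, q j ^ 2 ≤ 2 * β * energyForm β q v e := by
  rw [energyForm, Finset.mul_sum]
  refine Finset.sum_le_sum fun j _ => ?_
  have h1 : 0 ≤ 2 * β * (β / 2 * ∑ i, v i j ^ 2 + β / 2 * e j ^ 2) := by positivity
  have h2 : 2 * β * ((n + 1) / (2 * β) * q j ^ 2) = n * q j ^ 2 + q j ^ 2 := by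
    field_simp
  have h3 : 0 ≤ (n : ℝ) * q j ^ 2 := by positivity
  linarith

lemma sq_le_energyForm {β : ℝ} (hβ : 0 < β) (q : Fin m → ℝ) (v : Fin n → Fin m → ℝ)
    (e : Fin m → ℝ) (i : Fin n) (j : Fin m) : β / 2 * v i j ^ 2 ≤ energyForm β q v e := by
  rw [energyForm]
  refine le_trans ?_ (Finset.single_le_sum (f := fun j =>
    ((n + 1) / (2 * β) * q j ^ 2 + β / 2 * ∑ i, v i j ^ 2 + β / 2 * e j ^ 2))
    (fun j _ => by positivity) (Finset.mem_univ j))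
  have h1 : v i j ^ 2 ≤ ∑ i, v i j ^ 2 :=
    Finset.single_le_sum (f := fun i => v i j ^ 2) (fun i _ => by positivity) (Finset.mem_univ i)
  have h2 : 0 ≤ (n + 1) / (2 * β) * q j ^ 2 := by positivity
  have h3 : 0 ≤ β / 2 * e j ^ 2 := by positivity
  have h4 := mul_le_mul_of_nonneg_left h1 (half_pos hβ).le
  linarith

/-- The polarization `2(a - b)(c - a) = (c - b)² - (c - a)² - (a - b)²`, applied to prices, baseline
demands and excess, for one good. The reference `z` need not exhaust the capacity: the reference
value of the excess is `0`. -/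
lemma three_point_identity {β : ℝ} (hβ : 0 < β) (Y Y' z : Fin n → ℝ) (s p r d d' : ℝ)
    (hd : d = ∑ i, Y i - s) (hd' : d' = ∑ i, Y' i - s) :
    ∑ i, (p + β * d' + β * (Y' i - Y i)) * (z i - (Y' i + d'))
      - (p + β * d') * (∑ i, z i - s) + r * ((n + 1) * d')
      = ((n + 1) / (2 * β) * (r - p) ^ 2 + β / 2 * ∑ i, (z i - Y i) ^ 2 + β / 2 * d ^ 2)
        - ((n + 1) / (2 * β) * (r - (p + β * d')) ^ 2 + β / 2 * ∑ i, (z i - Y' i) ^ 2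
          + β / 2 * d' ^ 2)
        - ((n + 1) / (2 * β) * (p + β * d' - p) ^ 2 + β / 2 * ∑ i, (Y' i - Y i) ^ 2
          + β / 2 * (d' - d) ^ 2) := by
  have h1 : ∑ i, (p + β * d' + β * (Y' i - Y i)) * (z i - (Y' i + d'))
      = (p + β * d') * (∑ i, z i - ∑ i, Y' i - n * d') - β * d' * (∑ i, Y' i - ∑ i, Y i)
        + β / 2 * ∑ i, (z i - Y i) ^ 2 - β / 2 * ∑ i, (z i - Y' i) ^ 2
        - β / 2 * ∑ i, (Y' i - Y i) ^ 2 := by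
    -- With the constant written as a sum over the agents, the identity can be checked agent by
    -- agent.
    have h2 : (n : ℝ) * d' = ∑ _i : Fin n, d' := by simp
    rw [h2]
    simp only [Finset.mul_sum, ← Finset.sum_sub_distrib, ← Finset.sum_add_distrib]
    exact Finset.sum_congr rfl fun i _ => by ring
  have e : ∑ i, Y i = d + s := by rw [hd]; ring
  have e' : ∑ i, Y' i = d' + s := by rw [hd']; ring
  rw [h1, e, e']
  field_simp
  ring

lemma IsADMMStep.lagrangian_gap {β : ℝ} {y x' y' : Fin n → Fin m → ℝ} {p p' : Fin m → ℝ}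
    (hw : ∀ i, 0 < M.budget i)
    (hconc : ∀ i, ConcaveOn ℝ (nonnegOrthant m) (M.utility i)) (hβ : 0 < β)
    (h : M.IsADMMStep β y p x' y' p') {z : Fin n → Fin m → ℝ} (hz : ∀ i, z i ∈ M.logDomain i)
    (r : Fin m → ℝ) :
    M.lagrangian z p' - M.lagrangian x' r
      ≤ M.energy β y p z r - M.energy β y' p' z r - M.movement β y p y' p' := by
  have hv := h.variational hw hconc hβ hz
  have hid : ∑ j, ∑ i, (p' j + β * (y' i j - y i j)) * (z i j - x' i j)
      - ∑ j, p' j * (∑ i, z i j - M.capacity j) + ∑ j, r j * (∑ i, x' i j - M.capacity j)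
      = M.energy β y p z r - M.energy β y' p' z r - M.movement β y p y' p' := by
    simp only [energy, movement, energyForm, ← Finset.sum_sub_distrib, ← Finset.sum_add_distrib]
    refine Finset.sum_congr rfl fun j _ => ?_
    rw [h.excess_demand hβ j]
    simp only [h.demand_eq hβ, h.price_eq j]
    exact three_point_identity hβ (fun i => y i j) (fun i => y' i j) (fun i => z i j)
      (M.capacity j) (p j) (r j) _ _ rfl rfl
  simp only [lagrangian]
  linarith

lemma two_step_identity {β : ℝ} (hβ : 0 < β) (Y Y' Y'' : Fin n → ℝ) (s p : ℝ) (d d' d'' : ℝ)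
    (hd : d = ∑ i, Y i - s) (hd' : d' = ∑ i, Y' i - s) (hd'' : d'' = ∑ i, Y'' i - s) :
    ∑ i, (p + β * d' + β * (Y' i - Y i)) * (Y'' i + d'' - (Y' i + d'))
      + ∑ i, (p + β * d' + β * d'' + β * (Y'' i - Y' i)) * (Y' i + d' - (Y'' i + d''))
      = ((n + 1) / (2 * β) * (p + β * d' - p) ^ 2 + β / 2 * ∑ i, (Y' i - Y i) ^ 2
          + β / 2 * (d' - d) ^ 2)
        - ((n + 1) / (2 * β) * (p + β * d' + β * d'' - (p + β * d')) ^ 2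
          + β / 2 * ∑ i, (Y'' i - Y' i) ^ 2 + β / 2 * (d'' - d') ^ 2)
        - ((n + 1) * β / 2 * (d'' - d') ^ 2 + β / 2 * ∑ i, (Y'' i - Y' i - (Y' i - Y i)) ^ 2
          + β / 2 * (d'' - d' - (d' - d)) ^ 2) := by
  have h1 : ∑ i, (p + β * d' + β * (Y' i - Y i)) * (Y'' i + d'' - (Y' i + d'))
      + ∑ i, (p + β * d' + β * d'' + β * (Y'' i - Y' i)) * (Y' i + d' - (Y'' i + d''))
      = - (β * d'') * (∑ i, Y'' i - ∑ i, Y' i + n * (d'' - d'))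
        - β * (d'' - d') * (∑ i, Y'' i - ∑ i, Y' i - (∑ i, Y' i - ∑ i, Y i))
        + β / 2 * ∑ i, (Y' i - Y i) ^ 2 - β / 2 * ∑ i, (Y'' i - Y' i) ^ 2
        - β / 2 * ∑ i, (Y'' i - Y' i - (Y' i - Y i)) ^ 2 := by
    have h2 : (n : ℝ) * (d'' - d') = ∑ _i : Fin n, (d'' - d') := by
      rw [Finset.sum_const, Finset.card_univ, Fintype.card_fin, nsmul_eq_mul]
    rw [h2]
    simp only [Finset.mul_sum, ← Finset.sum_sub_distrib, ← Finset.sum_add_distrib]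
    exact Finset.sum_congr rfl fun i _ => by ring
  have e : ∑ i, Y i = d + s := by rw [hd]; ring
  have e' : ∑ i, Y' i = d' + s := by rw [hd']; ring
  have e'' : ∑ i, Y'' i = d'' + s := by rw [hd'']; ring
  rw [h1, e, e', e'']
  field_simp
  ring

/-- Each of two consecutive demands is tested in the variational inequality of the other. In the sum
the objectives cancel, and what is left is the difference of the movements minus squares. -/
lemma IsADMMStep.movement_le {β : ℝ} {y x' y' x'' y'' : Fin n → Fin m → ℝ} {p p' p'' : Fin m → ℝ}
    (hw : ∀ i, 0 < M.budget i)
    (hconc : ∀ i, ConcaveOn ℝ (nonnegOrthant m) (M.utility i)) (hβ : 0 < β)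
    (h : M.IsADMMStep β y p x' y' p') (h' : M.IsADMMStep β y' p' x'' y'' p'') :
    M.movement β y' p' y'' p'' ≤ M.movement β y p y' p' := by
  have hv := h.variational hw hconc hβ h'.mem_logDomain
  have hv' := h'.variational hw hconc hβ h.mem_logDomain
  have hle : ∑ j, ∑ i, (p' j + β * (y' i j - y i j)) * (x'' i j - x' i j)
      + ∑ j, ∑ i, (p'' j + β * (y'' i j - y' i j)) * (x' i j - x'' i j)
      ≤ M.movement β y p y' p' - M.movement β y' p' y'' p'' := by
    simp only [movement, energyForm, ← Finset.sum_sub_distrib, ← Finset.sum_add_distrib]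
    refine Finset.sum_le_sum fun j _ => ?_
    rw [Finset.sum_add_distrib]
    simp only [h'.demand_eq hβ, h.demand_eq hβ, h'.price_eq j, h.price_eq j]
    rw [two_step_identity hβ (fun i => y i j) (fun i => y' i j) (fun i => y'' i j)
      (M.capacity j) (p j) (M.excess y j) (M.excess y' j) (M.excess y'' j) rfl rfl rfl]
    refine sub_le_self _ ?_
    positivity
  linarith

/-! ### Well-posedness of a round -/

lemma exists_utility_le {u : (Fin m → ℝ) → ℝ} (hdeg : IsHomogeneousDegreeOne u)
    (hcont : ContinuousOn u (nonnegOrthant m)) :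
    ∃ B : ℝ, 0 < B ∧ ∀ ξ ∈ nonnegOrthant m, u ξ ≤ B * (1 + ‖ξ‖) := by
  have hclosed : IsClosed (nonnegOrthant m) := by
    have : nonnegOrthant m = ⋂ j, {x | 0 ≤ x j} := by ext x; simp [nonnegOrthant]
    rw [this]
    exact isClosed_iInter fun j => isClosed_le (by fun_prop) (by fun_prop)
  have hK : IsCompact (Metric.closedBall (0 : Fin m → ℝ) 1 ∩ nonnegOrthant m) :=
    (isCompact_closedBall 0 1).inter_right hclosed
  obtain ⟨B, hB⟩ := hK.bddAbove_image (hcont.mono Set.inter_subset_right)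
  -- Scaling by `1 + ‖ξ‖` rather than `‖ξ‖` moves every bundle, including `0`, into the compact part
  -- of the unit ball by a positive factor.
  refine ⟨max B 1, by positivity, fun ξ hξ => ?_⟩
  have hN : 0 < 1 + ‖ξ‖ := by positivity
  have hmem : (1 + ‖ξ‖)⁻¹ • ξ ∈ nonnegOrthant m := fun j =>
    mul_nonneg (inv_nonneg.2 hN.le) (hξ j)
  have hball : (1 + ‖ξ‖)⁻¹ • ξ ∈ Metric.closedBall (0 : Fin m → ℝ) 1 := by
    rw [mem_closedBall_zero_iff, norm_smul, norm_inv, Real.norm_of_nonneg hN.le,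
      inv_mul_le_iff₀ hN]
    linarith
  have h1 : u ((1 + ‖ξ‖)⁻¹ • ξ) ≤ max B 1 :=
    (hB (Set.mem_image_of_mem u ⟨hball, hmem⟩)).trans (le_max_left _ _)
  have h2 := hdeg _ hmem _ hN
  rw [smul_inv_smul₀ hN.ne'] at h2
  rw [h2, mul_comm]
  exact mul_le_mul_of_nonneg_right h1 hN.le

lemma norm_sq_le_sum_sq (ξ : Fin m → ℝ) : ‖ξ‖ ^ 2 ≤ ∑ j, ξ j ^ 2 := by
  have h0 : 0 ≤ ∑ j, ξ j ^ 2 := by positivity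
  have h : ‖ξ‖ ≤ √(∑ j, ξ j ^ 2) := by
    refine (pi_norm_le_iff_of_nonneg (Real.sqrt_nonneg _)).2 fun j => ?_
    rw [Real.norm_eq_abs]
    exact Real.abs_le_sqrt (Finset.single_le_sum (f := fun j => ξ j ^ 2)
      (fun j _ => sq_nonneg _) (Finset.mem_univ j))
  exact (Real.le_sqrt (norm_nonneg _) h0).1 h

lemma proximal_term_le {β : ℝ} (hβ : 0 < β) (p y ξ : Fin m → ℝ) :
    -∑ j, p j * ξ j - β / 2 * ∑ j, (ξ j - y j) ^ 2
      ≤ ∑ j, (β * y j - p j) ^ 2 / β - β / 4 * ‖ξ‖ ^ 2 := by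
  have h1 : -∑ j, p j * ξ j - β / 2 * ∑ j, (ξ j - y j) ^ 2
      ≤ ∑ j, (β * y j - p j) ^ 2 / β - β / 4 * ∑ j, ξ j ^ 2 := by
    simp only [Finset.mul_sum, ← Finset.sum_sub_distrib, ← Finset.sum_neg_distrib]
    refine Finset.sum_le_sum fun j _ => ?_
    have h2 : 0 ≤ (β * y j - p j - β / 2 * ξ j) ^ 2 / β := by positivity
    have h3 : (β * y j - p j - β / 2 * ξ j) ^ 2 / β
        = (β * y j - p j) ^ 2 / β - (β * y j - p j) * ξ j + β / 4 * ξ j ^ 2 := by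
      field_simp
      ring
    have h4 : 0 ≤ β / 2 * y j ^ 2 := by positivity
    linarith
  have h2 := mul_le_mul_of_nonneg_left (norm_sq_le_sum_sq ξ) (by positivity : 0 ≤ β / 4)
  linarith

/-- The logarithmic domain need not be closed. The exponential of the objective divided by the
budget is `u * exp (q / w)`, which is continuous on the closed admissible set and eventually below
its value at a bundle of positive utility, since the Gaussian decay beats the linear growth of `u`.
-/
lemma exists_demand (hw : ∀ i, 0 < M.budget i) (hdeg : ∀ i, IsHomogeneousDegreeOne (M.utility i))
    (hpos : ∀ i, ∃ x ∈ M.admissible i, 0 < M.utility i x)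
    (hcont : ∀ i, ContinuousOn (M.utility i) (nonnegOrthant m)) {β : ℝ} (hβ : 0 < β)
    (i : Fin n) (p y : Fin m → ℝ) :
    ∃ x ∈ M.logDomain i, IsMaxOn (fun ξ : Fin m → ℝ =>
      M.budget i * Real.log (M.utility i ξ) - ∑ j, p j * ξ j
        - β / 2 * ∑ j, (ξ j - y j) ^ 2) (M.logDomain i) x := by
  obtain ⟨z, hz, hzpos⟩ := hpos i
  obtain ⟨B, hB, hbound⟩ := exists_utility_le (hdeg i) (hcont i)
  set w := M.budget i with hwdef
  have hwi : 0 < w := hw i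
  set q : (Fin m → ℝ) → ℝ := fun ξ => -∑ j, p j * ξ j - β / 2 * ∑ j, (ξ j - y j) ^ 2 with hq
  set g : (Fin m → ℝ) → ℝ := fun ξ => M.utility i ξ * Real.exp (q ξ / w) with hg
  have hgcont : ContinuousOn g (M.admissible i) :=
    ((hcont i).mono fun ξ hξ => hξ.1).mul (Continuous.continuousOn (by fun_prop))
  have hgz : 0 < g z := mul_pos hzpos (Real.exp_pos _)
  set A := ∑ j, (β * y j - p j) ^ 2 / β with hA
  have hgle : ∀ ξ ∈ M.admissible i, g ξ ≤ B * Real.exp (A / w + 4 * w / β - ‖ξ‖) := by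
    intro ξ hξ
    have h1 : q ξ / w ≤ (A - β / 4 * ‖ξ‖ ^ 2) / w :=
      div_le_div_of_nonneg_right (proximal_term_le hβ p y ξ) hwi.le
    have h2 : ‖ξ‖ + (A - β / 4 * ‖ξ‖ ^ 2) / w ≤ A / w + 4 * w / β - ‖ξ‖ := by
      -- This square absorbs `2 * ‖ξ‖` into the quadratic decay: one `‖ξ‖` pays for the growth of
      -- the utility, the other is left to force decay at infinity.
      have h3 : 0 ≤ (β / 4 * ‖ξ‖ - w) ^ 2 * (4 / (w * β)) := by positivity
      have h4 : (β / 4 * ‖ξ‖ - w) ^ 2 * (4 / (w * β))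
          = β / 4 * ‖ξ‖ ^ 2 / w - 2 * ‖ξ‖ + 4 * w / β := by
        field_simp
        ring
      rw [sub_div]
      linarith
    calc g ξ ≤ B * (1 + ‖ξ‖) * Real.exp (q ξ / w) :=
          mul_le_mul_of_nonneg_right (hbound ξ hξ.1) (Real.exp_pos _).le
      _ ≤ B * Real.exp ‖ξ‖ * Real.exp (q ξ / w) := by
          gcongr
          linarith [Real.add_one_le_exp ‖ξ‖]
      _ = B * Real.exp (‖ξ‖ + q ξ / w) := by rw [mul_assoc, ← Real.exp_add]
      _ ≤ B * Real.exp (A / w + 4 * w / β - ‖ξ‖) := by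
          gcongr
          linarith
  have hlim : Tendsto (fun ξ : Fin m → ℝ => B * Real.exp (A / w + 4 * w / β - ‖ξ‖))
      (cocompact (Fin m → ℝ)) (𝓝 0) := by
    have h1 : Tendsto (fun ξ : Fin m → ℝ => A / w + 4 * w / β - ‖ξ‖)
        (cocompact (Fin m → ℝ)) atBot :=
      tendsto_atBot_add_const_left _ _
        (tendsto_neg_atTop_atBot.comp (tendsto_norm_cocompact_atTop (E := Fin m → ℝ)))
    simpa using (Real.tendsto_exp_atBot.comp h1).const_mul B
  have hev : ∀ᶠ ξ in cocompact (Fin m → ℝ) ⊓ 𝓟 (M.admissible i), g ξ ≤ g z := by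
    filter_upwards [(hlim.eventually_lt_const hgz).filter_mono inf_le_left,
      mem_inf_of_right (mem_principal_self _)] with ξ h1 h2
    exact (hgle ξ h2).trans h1.le
  obtain ⟨x, hx, hmax⟩ := hgcont.exists_isMaxOn' (M.isClosed_admissible i) hz hev
  have hxpos : 0 < M.utility i x :=
    pos_of_mul_pos_left (hgz.trans_le (hmax hz)) (Real.exp_pos _).le
  refine ⟨x, ⟨hx, hxpos⟩, fun ξ hξ => ?_⟩
  have hlog : ∀ ζ ∈ M.logDomain i, w * Real.log (g ζ)
      = w * Real.log (M.utility i ζ) - ∑ j, p j * ζ j - β / 2 * ∑ j, (ζ j - y j) ^ 2 := by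
    intro ζ hζ
    rw [hg]
    simp only []
    rw [Real.log_mul hζ.2.ne' (Real.exp_pos _).ne', Real.log_exp, mul_add,
      mul_div_cancel₀ _ hwi.ne', hq]
    ring
  have h1 := mul_le_mul_of_nonneg_left
    (Real.log_le_log (mul_pos hξ.2 (Real.exp_pos _)) (hmax hξ.1)) hwi.le
  exact (hlog ξ hξ).symm.trans_le (h1.trans_eq (hlog x ⟨hx, hxpos⟩))

/-- Strong concavity of the proximal term: adding the first-order conditions of both maximizers,
each tested at the other, leaves `β ∑ (x - x')² ≤ 0`. -/
lemma demand_unique (hw : ∀ i, 0 < M.budget i)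
    (hconc : ∀ i, ConcaveOn ℝ (nonnegOrthant m) (M.utility i)) {β : ℝ} (hβ : 0 < β)
    {i : Fin n} {p y x x' : Fin m → ℝ} (hx : x ∈ M.logDomain i) (hx' : x' ∈ M.logDomain i)
    (hmax : IsMaxOn (fun ξ : Fin m → ℝ => M.budget i * Real.log (M.utility i ξ)
      - ∑ j, p j * ξ j - β / 2 * ∑ j, (ξ j - y j) ^ 2) (M.logDomain i) x)
    (hmax' : IsMaxOn (fun ξ : Fin m → ℝ => M.budget i * Real.log (M.utility i ξ)
      - ∑ j, p j * ξ j - β / 2 * ∑ j, (ξ j - y j) ^ 2) (M.logDomain i) x') : x = x' := by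
  have h1 := variational_of_isMaxOn (concaveOn_budget_mul_log hw hconc i) hx hmax hx'
  have h2 := variational_of_isMaxOn (concaveOn_budget_mul_log hw hconc i) hx' hmax' hx
  have h3 : ∑ j, (p j + β * (x j - y j)) * (x' j - x j)
      + ∑ j, (p j + β * (x' j - y j)) * (x j - x' j) = -(β * ∑ j, (x j - x' j) ^ 2) := by
    rw [Finset.mul_sum, ← Finset.sum_add_distrib, ← Finset.sum_neg_distrib]
    exact Finset.sum_congr rfl fun j _ => by ring
  have h4 : ∑ j, (x j - x' j) ^ 2 ≤ 0 := by
    by_contra hcon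
    push Not at hcon
    have := mul_pos hβ hcon
    linarith
  have h5 := le_antisymm h4 (by positivity)
  rw [Finset.sum_eq_zero_iff_of_nonneg (fun j _ => by positivity)] at h5
  exact funext fun j => sub_eq_zero.1 (pow_eq_zero_iff two_ne_zero |>.1 (h5 j (Finset.mem_univ j)))

lemma existsUnique_admmStep (hw : ∀ i, 0 < M.budget i)
    (hconc : ∀ i, ConcaveOn ℝ (nonnegOrthant m) (M.utility i))
    (hdeg : ∀ i, IsHomogeneousDegreeOne (M.utility i))
    (hpos : ∀ i, ∃ x ∈ M.admissible i, 0 < M.utility i x)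
    (hcont : ∀ i, ContinuousOn (M.utility i) (nonnegOrthant m)) {β : ℝ} (hβ : 0 < β)
    (y : Fin n → Fin m → ℝ) (p : Fin m → ℝ) :
    ∃! z : (Fin n → Fin m → ℝ) × (Fin n → Fin m → ℝ) × (Fin m → ℝ),
      M.IsADMMStep β y p z.1 z.2.1 z.2.2 := by
  choose x hx hmax using fun i => exists_demand hw hdeg hpos hcont hβ i p (y i)
  refine ⟨(x, M.baselineStep x, fun j => p j + β * M.excess (M.baselineStep x) j),
    ⟨fun i => ⟨hx i, hmax i⟩, (isMaxOn_baseline_iff hβ x _).2 rfl, fun j => rfl⟩, ?_⟩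
  rintro ⟨x', y', p'⟩ ⟨h1, h2, h3⟩
  simp only at h1 h2 h3
  obtain rfl : x' = x := funext fun i =>
    demand_unique hw hconc hβ (h1 i).1 (hx i) (h1 i).2 (hmax i)
  obtain rfl := (isMaxOn_baseline_iff hβ x' y').1 h2
  obtain rfl : p' = fun j => p j + β * M.excess (M.baselineStep x') j := funext h3
  rfl

/-! ### Equilibria as saddle points of the Lagrangian -/

/-- `(x, q)` is a saddle point of the Lagrangian of the social problem. -/
def IsSaddlePoint (M : FisherMarket n m) (q : Fin m → ℝ) (x : Fin n → Fin m → ℝ) : Prop :=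
  (∀ i, x i ∈ M.logDomain i) ∧ (∀ j, ∑ i, x i j = M.capacity j) ∧
    ∀ z : Fin n → Fin m → ℝ, (∀ i, z i ∈ M.logDomain i) → M.lagrangian z q ≤ M.socialObjective x

lemma lagrangian_eq_sum (z : Fin n → Fin m → ℝ) (q : Fin m → ℝ) :
    M.lagrangian z q
      = ∑ i, (M.budget i * Real.log (M.utility i (z i)) - ∑ j, q j * z i j)
        + ∑ j, q j * M.capacity j := by
  have h : ∑ j, q j * (∑ i, z i j - M.capacity j)
      = ∑ i, ∑ j, q j * z i j - ∑ j, q j * M.capacity j := by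
    rw [Finset.sum_comm, ← Finset.sum_sub_distrib]
    exact Finset.sum_congr rfl fun j _ => by rw [mul_sub, Finset.mul_sum]
  rw [lagrangian, h, Finset.sum_sub_distrib, socialObjective]
  ring

lemma lagrangian_eq_socialObjective {x : Fin n → Fin m → ℝ}
    (hx : ∀ j, ∑ i, x i j = M.capacity j) (q : Fin m → ℝ) :
    M.lagrangian x q = M.socialObjective x := by
  simp [lagrangian, hx]

lemma IsOptimalBundle.mem_logDomain (hhom : M.HasHomogeneousConstraints)
    (hdeg : ∀ i, IsHomogeneousDegreeOne (M.utility i)) {i : Fin n} (hw : 0 < M.budget i)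
    (hpos : ∃ x ∈ M.admissible i, 0 < M.utility i x) {p x : Fin m → ℝ}
    (h : M.IsOptimalBundle i p x) : x ∈ M.logDomain i := by
  obtain ⟨z, hz, hzpos⟩ := hpos
  refine ⟨h.1.1, ?_⟩
  set c := ∑ j, p j * z j with hc
  -- A factor that makes `z` affordable whatever the sign of its cost, prices being of any sign.
  have ht : 0 < M.budget i / (M.budget i + |c|) := by positivity
  have hcost : ∑ j, p j * ((M.budget i / (M.budget i + |c|)) • z) j ≤ M.budget i := by
    have h1 : ∑ j, p j * ((M.budget i / (M.budget i + |c|)) • z) j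
        = M.budget i / (M.budget i + |c|) * c := by
      rw [hc, Finset.mul_sum]
      exact Finset.sum_congr rfl fun j _ => by simp only [Pi.smul_apply, smul_eq_mul]; ring
    rw [h1, div_mul_eq_mul_div, div_le_iff₀ (by positivity)]
    exact mul_le_mul_of_nonneg_left (by linarith [le_abs_self c]) hw.le
  have h2 := h.2 _ (smul_mem_admissible hhom hz ht) hcost
  rw [hdeg i z hz.1 _ ht] at h2
  exact (mul_pos ht hzpos).trans_le h2

/-- Rescaling `z` to cost exactly the budget compares its utility with that of `x`; `log t ≤ t - 1`
then trades the budget constraint for the linear cost. -/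
lemma IsOptimalBundle.log_utility_sub_cost_le (hhom : M.HasHomogeneousConstraints)
    (hdeg : ∀ i, IsHomogeneousDegreeOne (M.utility i)) {i : Fin n} (hw : 0 < M.budget i)
    {p x z : Fin m → ℝ} (h : M.IsOptimalBundle i p x) (hz : z ∈ M.logDomain i) :
    M.budget i * Real.log (M.utility i z) - ∑ j, p j * z j
      ≤ M.budget i * Real.log (M.utility i x) - M.budget i := by
  set c := ∑ j, p j * z j with hc
  have hcost : ∀ t : ℝ, ∑ j, p j * (t • z) j = t * c := fun t => by
    rw [hc, Finset.mul_sum]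
    exact Finset.sum_congr rfl fun j _ => by simp only [Pi.smul_apply, smul_eq_mul]; ring
  have hscale : ∀ t : ℝ, 0 < t → t * c ≤ M.budget i → t * M.utility i z ≤ M.utility i x :=
    fun t ht htc => by
      have := h.2 _ (smul_mem_admissible hhom hz.1 ht) ((hcost t).trans_le htc)
      rwa [hdeg i z hz.1.1 t ht] at this
  -- A bundle of positive utility and nonpositive cost could be scaled up without limit and would
  -- beat `x`.
  have hcpos : 0 < c := by
    by_contra hcon
    push Not at hcon
    have hz2 := hz.2
    have ht : 0 < (|M.utility i x| + 1) / M.utility i z := by positivity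
    have h1 := hscale _ ht ((mul_nonpos_of_nonneg_of_nonpos ht.le hcon).trans hw.le)
    rw [div_mul_cancel₀ _ hz2.ne'] at h1
    linarith [le_abs_self (M.utility i x)]
  have ht : 0 < M.budget i / c := by positivity
  have h1 := hscale _ ht (div_mul_cancel₀ _ hcpos.ne').le
  have h2 := Real.log_le_log (mul_pos ht hz.2) h1
  rw [Real.log_mul ht.ne' hz.2.ne'] at h2
  have h3 : Real.log (c / M.budget i) ≤ c / M.budget i - 1 :=
    Real.log_le_sub_one_of_pos (by positivity)
  have h4 : Real.log (M.budget i / c) = -Real.log (c / M.budget i) := by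
    rw [← Real.log_inv, inv_div]
  have h5 := mul_le_mul_of_nonneg_left
    (by linarith : Real.log (M.utility i z) ≤ Real.log (M.utility i x) + (c / M.budget i - 1)) hw.le
  have h6 : M.budget i * (Real.log (M.utility i x) + (c / M.budget i - 1))
      = M.budget i * Real.log (M.utility i x) + c - M.budget i := by
    field_simp
    ring
  linarith

lemma IsEquilibrium.isSaddlePoint (hhom : M.HasHomogeneousConstraints)
    (hw : ∀ i, 0 < M.budget i) (hdeg : ∀ i, IsHomogeneousDegreeOne (M.utility i))
    (hpos : ∀ i, ∃ x ∈ M.admissible i, 0 < M.utility i x) {p : Fin m → ℝ}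
    {x : Fin n → Fin m → ℝ} (h : M.IsEquilibrium p x) : M.IsSaddlePoint p x := by
  refine ⟨fun i => (h.1 i).mem_logDomain hhom hdeg (hw i) (hpos i), h.2.1, fun z hz => ?_⟩
  rw [← lagrangian_eq_socialObjective h.2.1 p, lagrangian_eq_sum, lagrangian_eq_sum]
  refine add_le_add_left (Finset.sum_le_sum fun i _ => ?_) _
  rw [h.2.2 i]
  exact (h.1 i).log_utility_sub_cost_le hhom hdeg (hw i) (hz i)

lemma IsSaddlePoint.log_utility_sub_cost_le {q : Fin m → ℝ} {x : Fin n → Fin m → ℝ}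
    (h : M.IsSaddlePoint q x) (i : Fin n) {ζ : Fin m → ℝ} (hζ : ζ ∈ M.logDomain i) :
    M.budget i * Real.log (M.utility i ζ) - ∑ j, q j * ζ j
      ≤ M.budget i * Real.log (M.utility i (x i)) - ∑ j, q j * x i j := by
  have h1 := h.2.2 (Function.update x i ζ) fun k => by
    rcases eq_or_ne k i with rfl | hk
    · simpa using hζ
    · simpa [hk] using h.1 k
  rw [← lagrangian_eq_socialObjective h.2.1 q, lagrangian_eq_sum, lagrangian_eq_sum,
    Fintype.sum_eq_add_sum_compl i, Fintype.sum_eq_add_sum_compl i] at h1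
  have h2 : ∑ k ∈ {i}ᶜ, (M.budget k * Real.log (M.utility k (Function.update x i ζ k))
        - ∑ j, q j * Function.update x i ζ k j)
      = ∑ k ∈ {i}ᶜ, (M.budget k * Real.log (M.utility k (x k)) - ∑ j, q j * x k j) :=
    Finset.sum_congr rfl fun k hk => by
      rw [Function.update_of_ne (by simpa using hk)]
  rw [h2, Function.update_self] at h1
  linarith

/-- Along the ray `t • x i` the agent's objective is `w log t - t c` up to a constant. It is maximal
at `t = 1`, so its derivative `w - c` vanishes there. -/
lemma IsSaddlePoint.cost_eq_budget (hhom : M.HasHomogeneousConstraints)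
    (hdeg : ∀ i, IsHomogeneousDegreeOne (M.utility i)) {q : Fin m → ℝ} {x : Fin n → Fin m → ℝ}
    (h : M.IsSaddlePoint q x) (i : Fin n) : ∑ j, q j * x i j = M.budget i := by
  set c := ∑ j, q j * x i j with hc
  have hray : ∀ t : ℝ, 0 < t → M.budget i * Real.log t - (t - 1) * c ≤ 0 := by
    intro t ht
    have h1 := h.log_utility_sub_cost_le i (smul_mem_logDomain hhom hdeg (h.1 i) ht)
    have h2 : ∑ j, q j * (t • x i) j = t * c := by
      rw [hc, Finset.mul_sum]
      exact Finset.sum_congr rfl fun j _ => by simp only [Pi.smul_apply, smul_eq_mul]; ring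
    rw [hdeg i _ (h.1 i).1.1 t ht, h2, Real.log_mul ht.ne' (h.1 i).2.ne'] at h1
    linarith
  have hderiv : HasDerivAt (fun t : ℝ => M.budget i * Real.log t - (t - 1) * c)
      (M.budget i * (1 : ℝ)⁻¹ - 1 * c) 1 :=
    ((Real.hasDerivAt_log one_ne_zero).const_mul _).sub
      (((hasDerivAt_id (1 : ℝ)).sub_const 1).mul_const c)
  have hmax : IsLocalMax (fun t : ℝ => M.budget i * Real.log t - (t - 1) * c) 1 := by
    filter_upwards [Ioi_mem_nhds (zero_lt_one' ℝ)] with t ht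
    simpa using hray t ht
  have := hmax.hasDerivAt_eq_zero hderiv
  linarith

lemma IsSaddlePoint.isEquilibrium (hhom : M.HasHomogeneousConstraints)
    (hw : ∀ i, 0 < M.budget i) (hdeg : ∀ i, IsHomogeneousDegreeOne (M.utility i))
    {q : Fin m → ℝ} {x : Fin n → Fin m → ℝ} (h : M.IsSaddlePoint q x) : M.IsEquilibrium q x := by
  refine ⟨fun i => ⟨⟨(h.1 i).1, (h.cost_eq_budget hhom hdeg i).le⟩, fun z hz hcost => ?_⟩,
    h.2.1, h.cost_eq_budget hhom hdeg⟩
  rcases le_or_gt (M.utility i z) 0 with hu | hu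
  · exact hu.trans (h.1 i).2.le
  · have h1 := h.log_utility_sub_cost_le i (ζ := z) ⟨hz, hu⟩
    rw [h.cost_eq_budget hhom hdeg i] at h1
    have h2 : M.budget i * Real.log (M.utility i z)
        ≤ M.budget i * Real.log (M.utility i (x i)) := by linarith
    exact (Real.log_le_log_iff hu (h.1 i).2).1 (le_of_mul_le_mul_left h2 (hw i))

lemma IsSaddlePoint.isSocialOptimum {q : Fin m → ℝ} {x : Fin n → Fin m → ℝ}
    (h : M.IsSaddlePoint q x) : M.IsSocialOptimum x x := by
  refine ⟨⟨h.1, h.2.1, rfl⟩, ?_⟩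
  rintro x' y' ⟨hx', hcap, rfl⟩
  exact (lagrangian_eq_socialObjective hcap q).symm.trans_le (h.2.2 _ hx')

lemma tendsto_zero_of_sq {a : ℕ → ℝ} (h : Tendsto (fun k => a k ^ 2) atTop (𝓝 0)) :
    Tendsto a atTop (𝓝 0) := by
  rw [tendsto_zero_iff_abs_tendsto_zero]
  simpa [Function.comp_def, Real.sqrt_sq_eq_abs] using h.sqrt

/-! ### Descent of the energy along a run -/

namespace IsADMMRun

variable {β : ℝ} {x y : ℕ → Fin n → Fin m → ℝ} {p : ℕ → Fin m → ℝ} {q : Fin m → ℝ}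
  {xs : Fin n → Fin m → ℝ}

/-- At a saddle point the gap in `IsADMMStep.lagrangian_gap` is nonnegative and can be dropped. -/
lemma movement_le_energy_sub (hw : ∀ i, 0 < M.budget i)
    (hconc : ∀ i, ConcaveOn ℝ (nonnegOrthant m) (M.utility i)) (hβ : 0 < β)
    (h : M.IsADMMRun β x y p) (hs : M.IsSaddlePoint q xs) (k : ℕ) :
    M.movement β (y k) (p k) (y (k + 1)) (p (k + 1))
      ≤ M.energy β (y k) (p k) xs q - M.energy β (y (k + 1)) (p (k + 1)) xs q := by
  have h1 := (h k).lagrangian_gap hw hconc hβ hs.1 q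
  have h2 := hs.2.2 _ (h k).mem_logDomain
  rw [lagrangian_eq_socialObjective hs.2.1] at h1
  linarith

lemma antitone_energy (hw : ∀ i, 0 < M.budget i)
    (hconc : ∀ i, ConcaveOn ℝ (nonnegOrthant m) (M.utility i)) (hβ : 0 < β)
    (h : M.IsADMMRun β x y p) (hs : M.IsSaddlePoint q xs) :
    Antitone fun k => M.energy β (y k) (p k) xs q :=
  antitone_nat_of_succ_le fun k => by
    have h1 := h.movement_le_energy_sub hw hconc hβ hs k
    have h2 : 0 ≤ M.movement β (y k) (p k) (y (k + 1)) (p (k + 1)) := energyForm_nonneg hβ _ _ _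
    linarith

/-- The first `k + 1` movements sum to at most the initial energy, and the last of them is the
smallest. -/
lemma movement_le_div (hw : ∀ i, 0 < M.budget i)
    (hconc : ∀ i, ConcaveOn ℝ (nonnegOrthant m) (M.utility i)) (hβ : 0 < β)
    (h : M.IsADMMRun β x y p) (hs : M.IsSaddlePoint q xs) (k : ℕ) :
    M.movement β (y k) (p k) (y (k + 1)) (p (k + 1))
      ≤ M.energy β (y 0) (p 0) xs q / ((k : ℝ) + 1) := by
  have hanti : Antitone fun k => M.movement β (y k) (p k) (y (k + 1)) (p (k + 1)) :=
    antitone_nat_of_succ_le fun k => (h k).movement_le hw hconc hβ (h (k + 1))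
  have h1 : ∑ l ∈ Finset.range (k + 1), M.movement β (y l) (p l) (y (l + 1)) (p (l + 1))
      ≤ M.energy β (y 0) (p 0) xs q := by
    refine (Finset.sum_le_sum fun l _ => h.movement_le_energy_sub hw hconc hβ hs l).trans ?_
    rw [Finset.sum_range_sub']
    exact sub_le_self _ (energyForm_nonneg hβ _ _ _)
  have h2 := Finset.card_nsmul_le_sum (Finset.range (k + 1))
    (fun l => M.movement β (y l) (p l) (y (l + 1)) (p (l + 1))) _
    fun l hl => hanti (Nat.lt_succ_iff.1 (Finset.mem_range.1 hl))
  rw [Finset.card_range, nsmul_eq_mul, Nat.cast_add, Nat.cast_one] at h2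
  rw [le_div_iff₀ (by positivity), mul_comm]
  exact h2.trans h1

lemma tendsto_movement (hw : ∀ i, 0 < M.budget i)
    (hconc : ∀ i, ConcaveOn ℝ (nonnegOrthant m) (M.utility i)) (hβ : 0 < β)
    (h : M.IsADMMRun β x y p) (hs : M.IsSaddlePoint q xs) :
    Tendsto (fun k => M.movement β (y k) (p k) (y (k + 1)) (p (k + 1))) atTop (𝓝 0) :=
  squeeze_zero (fun _ => energyForm_nonneg hβ _ _ _)
    (h.movement_le_div hw hconc hβ hs)
    ((tendsto_const_nhds (x := M.energy β (y 0) (p 0) xs q)).div_atTop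
      (tendsto_atTop_add_const_right _ _ tendsto_natCast_atTop_atTop))

lemma tendsto_excess (hw : ∀ i, 0 < M.budget i)
    (hconc : ∀ i, ConcaveOn ℝ (nonnegOrthant m) (M.utility i)) (hβ : 0 < β)
    (h : M.IsADMMRun β x y p) (hs : M.IsSaddlePoint q xs) (j : Fin m) :
    Tendsto (fun k => M.excess (y (k + 1)) j) atTop (𝓝 0) := by
  have h1 : Tendsto (fun k => β * M.excess (y (k + 1)) j) atTop (𝓝 0) := by
    refine tendsto_zero_of_sq (squeeze_zero (fun _ => sq_nonneg _) (fun k => ?_)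
      (by simpa using (h.tendsto_movement hw hconc hβ hs).const_mul (2 * β)))
    have h2 := sum_sq_le_energyForm hβ (fun j => p (k + 1) j - p k j)
      (fun i j => y (k + 1) i j - y k i j) (fun j => M.excess (y (k + 1)) j - M.excess (y k) j)
    refine le_trans ?_ h2
    have h3 : β * M.excess (y (k + 1)) j = p (k + 1) j - p k j := by
      rw [(h k).price_eq j]; ring
    rw [h3]
    exact Finset.single_le_sum (f := fun j => (p (k + 1) j - p k j) ^ 2)
      (fun j _ => sq_nonneg _) (Finset.mem_univ j)
  simpa [hβ.ne'] using h1.const_mul β⁻¹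

lemma tendsto_baseline_sub (hw : ∀ i, 0 < M.budget i)
    (hconc : ∀ i, ConcaveOn ℝ (nonnegOrthant m) (M.utility i)) (hβ : 0 < β)
    (h : M.IsADMMRun β x y p) (hs : M.IsSaddlePoint q xs) (i : Fin n) (j : Fin m) :
    Tendsto (fun k => y (k + 1) i j - y k i j) atTop (𝓝 0) := by
  have h1 : Tendsto (fun k => β / 2 * (y (k + 1) i j - y k i j) ^ 2) atTop (𝓝 0) :=
    squeeze_zero (fun _ => by positivity)
      (fun k => sq_le_energyForm hβ (fun j => p (k + 1) j - p k j)
        (fun i j => y (k + 1) i j - y k i j) (fun j => M.excess (y (k + 1)) j - M.excess (y k) j)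
        i j) (h.tendsto_movement hw hconc hβ hs)
  refine tendsto_zero_of_sq ?_
  have h2 := h1.const_mul (β / 2)⁻¹
  rw [mul_zero] at h2
  exact h2.congr fun k => inv_mul_cancel_left₀ (half_pos hβ).ne' _

lemma exists_abs_price_le (hw : ∀ i, 0 < M.budget i)
    (hconc : ∀ i, ConcaveOn ℝ (nonnegOrthant m) (M.utility i)) (hβ : 0 < β)
    (h : M.IsADMMRun β x y p) (hs : M.IsSaddlePoint q xs) :
    ∃ P : ℝ, 0 ≤ P ∧ ∀ k j, |q j - p k j| ≤ P := by
  refine ⟨√(2 * β * M.energy β (y 0) (p 0) xs q), Real.sqrt_nonneg _, fun k j => ?_⟩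
  refine Real.abs_le_sqrt ?_
  calc (q j - p k j) ^ 2 ≤ ∑ j, (q j - p k j) ^ 2 :=
        Finset.single_le_sum (f := fun j => (q j - p k j) ^ 2) (fun j _ => sq_nonneg _)
          (Finset.mem_univ j)
    _ ≤ 2 * β * M.energy β (y k) (p k) xs q :=
        sum_sq_le_energyForm hβ _ (fun i j => xs i j - y k i j) (M.excess (y k))
    _ ≤ 2 * β * M.energy β (y 0) (p 0) xs q :=
        mul_le_mul_of_nonneg_left (h.antitone_energy hw hconc hβ hs (Nat.zero_le k)) (by positivity)

lemma exists_abs_baseline_le (hw : ∀ i, 0 < M.budget i)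
    (hconc : ∀ i, ConcaveOn ℝ (nonnegOrthant m) (M.utility i)) (hβ : 0 < β)
    (h : M.IsADMMRun β x y p) (hs : M.IsSaddlePoint q xs) :
    ∃ Y : ℝ, ∀ k i j, |xs i j - y k i j| ≤ Y := by
  refine ⟨√(2 / β * M.energy β (y 0) (p 0) xs q), fun k i j => Real.abs_le_sqrt ?_⟩
  have h1 : β / 2 * (xs i j - y k i j) ^ 2 ≤ M.energy β (y 0) (p 0) xs q :=
    (sq_le_energyForm hβ (fun j => q j - p k j) (fun i j => xs i j - y k i j)
      (M.excess (y k)) i j).trans (h.antitone_energy hw hconc hβ hs (Nat.zero_le k))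
  calc (xs i j - y k i j) ^ 2 = 2 / β * (β / 2 * (xs i j - y k i j) ^ 2) := by field_simp
    _ ≤ _ := mul_le_mul_of_nonneg_left h1 (by positivity)

/-! ### Convergence of the prices -/

/-- Every subsequential limit of the prices supports the same allocation. -/
lemma isSaddlePoint_of_tendsto (hw : ∀ i, 0 < M.budget i)
    (hconc : ∀ i, ConcaveOn ℝ (nonnegOrthant m) (M.utility i)) (hβ : 0 < β)
    (h : M.IsADMMRun β x y p) (hs : M.IsSaddlePoint q xs) {ns : ℕ → ℕ}
    (hns : Tendsto ns atTop atTop) {q' : Fin m → ℝ}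
    (hq' : Tendsto (fun l => p (ns l)) atTop (𝓝 q')) : M.IsSaddlePoint q' xs := by
  refine ⟨hs.1, hs.2.1, fun z hz => ?_⟩
  obtain ⟨Y, hY⟩ := h.exists_abs_baseline_le hw hconc hβ hs
  have hexc := h.tendsto_excess hw hconc hβ hs
  -- The saddle inequality for `q` bounds the objective at `x (k + 1)`, which thus disappears. Only
  -- prices, excesses and baseline demands remain, and these pass to the limit.
  have hle : ∀ k, M.socialObjective z ≤ M.socialObjective xs
      + ∑ j, q j * ((n + 1) * M.excess (y (k + 1)) j)
      + ∑ j, ((p k j + β * M.excess (y (k + 1)) j)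
          * (∑ i, z i j - M.capacity j - (n + 1) * M.excess (y (k + 1)) j)
        + ∑ i, β * ((y (k + 1) i j - y k i j)
          * (z i j - y (k + 1) i j - M.excess (y (k + 1)) j))) := by
    intro k
    have h1 := (h k).variational hw hconc hβ hz
    have h2 := hs.2.2 _ (h k).mem_logDomain
    simp only [lagrangian, (h k).excess_demand hβ] at h2
    have h3 : ∑ j, ∑ i, (p (k + 1) j + β * (y (k + 1) i j - y k i j))
          * (z i j - x (k + 1) i j)
        = ∑ j, ((p k j + β * M.excess (y (k + 1)) j)
          * (∑ i, z i j - M.capacity j - (n + 1) * M.excess (y (k + 1)) j)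
        + ∑ i, β * ((y (k + 1) i j - y k i j)
          * (z i j - y (k + 1) i j - M.excess (y (k + 1)) j))) := by
      refine Finset.sum_congr rfl fun j _ => ?_
      have h4 : ∑ i, z i j - M.capacity j - (n + 1) * M.excess (y (k + 1)) j
          = ∑ i, (z i j - x (k + 1) i j) := by
        rw [← (h k).excess_demand hβ j, Finset.sum_sub_distrib]; ring
      rw [h4, ← (h k).price_eq j, Finset.mul_sum, ← Finset.sum_add_distrib]
      exact Finset.sum_congr rfl fun i _ => by rw [(h k).demand_eq hβ i j]; ring
    rw [h3] at h1
    linarith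
  have hq'j : ∀ j, Tendsto (fun l => p (ns l) j) atTop (𝓝 (q' j)) := tendsto_pi_nhds.1 hq'
  have hexc' : ∀ j, Tendsto (fun l => M.excess (y (ns l + 1)) j) atTop (𝓝 0) :=
    fun j => (hexc j).comp hns
  have hcross : ∀ i j, Tendsto (fun k => (y (k + 1) i j - y k i j)
      * (z i j - y (k + 1) i j - M.excess (y (k + 1)) j)) atTop (𝓝 0) := by
    intro i j
    have h1 : Tendsto (fun k => (z i j - y (k + 1) i j) * (y (k + 1) i j - y k i j))
        atTop (𝓝 0) := by
      -- The baseline demands are only known to be bounded, but they are multiplied by increments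
      -- that tend to zero.
      refine bdd_le_mul_tendsto_zero' (|z i j - xs i j| + Y) (Eventually.of_forall fun k => ?_)
        (h.tendsto_baseline_sub hw hconc hβ hs i j)
      calc |z i j - y (k + 1) i j| = |(z i j - xs i j) + (xs i j - y (k + 1) i j)| := by
            congr 1; ring
        _ ≤ |z i j - xs i j| + |xs i j - y (k + 1) i j| := abs_add_le _ _
        _ ≤ _ := by linarith [hY (k + 1) i j]
    have h2 := h1.sub ((h.tendsto_baseline_sub hw hconc hβ hs i j).mul (hexc j))
    rw [mul_zero, sub_zero] at h2
    exact h2.congr fun k => by ring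
  have hlim : Tendsto (fun l => M.socialObjective xs
      + ∑ j, q j * ((n + 1) * M.excess (y (ns l + 1)) j)
      + ∑ j, ((p (ns l) j + β * M.excess (y (ns l + 1)) j)
          * (∑ i, z i j - M.capacity j - (n + 1) * M.excess (y (ns l + 1)) j)
        + ∑ i, β * ((y (ns l + 1) i j - y (ns l) i j)
          * (z i j - y (ns l + 1) i j - M.excess (y (ns l + 1)) j)))) atTop
      (𝓝 (M.socialObjective xs + ∑ j, q j * ((n + 1) * 0)
        + ∑ j, ((q' j + β * 0) * (∑ i, z i j - M.capacity j - (n + 1) * 0)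
          + ∑ _i : Fin n, β * 0))) := by
    refine (tendsto_const_nhds.add (tendsto_finsetSum _ fun j _ =>
      ((hexc' j).const_mul _).const_mul _)).add (tendsto_finsetSum _ fun j _ => ?_)
    refine (((hq'j j).add ((hexc' j).const_mul β)).mul
      (tendsto_const_nhds.sub ((hexc' j).const_mul _))).add (tendsto_finsetSum _ fun i _ => ?_)
    exact ((hcross i j).comp hns).const_mul β
  have h1 := ge_of_tendsto' hlim fun l => hle (ns l)
  simp only [mul_zero, add_zero, sub_zero, Finset.sum_const_zero] at h1
  rw [lagrangian]
  linarith

lemma exists_tendsto_energy (hw : ∀ i, 0 < M.budget i)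
    (hconc : ∀ i, ConcaveOn ℝ (nonnegOrthant m) (M.utility i)) (hβ : 0 < β)
    (h : M.IsADMMRun β x y p) (hs : M.IsSaddlePoint q xs) :
    ∃ l, Tendsto (fun k => M.energy β (y k) (p k) xs q) atTop (𝓝 l) :=
  ⟨_, tendsto_atTop_ciInf (h.antitone_energy hw hconc hβ hs)
    ⟨0, by rintro _ ⟨k, rfl⟩; exact energyForm_nonneg hβ _ _ _⟩⟩

/-- Two saddle-point prices that are subsequential limits of the same run agree. -/
lemma price_limit_unique (hw : ∀ i, 0 < M.budget i)
    (hconc : ∀ i, ConcaveOn ℝ (nonnegOrthant m) (M.utility i)) (hβ : 0 < β)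
    (h : M.IsADMMRun β x y p) {q₁ q₂ : Fin m → ℝ} (hs₁ : M.IsSaddlePoint q₁ xs)
    (hs₂ : M.IsSaddlePoint q₂ xs) {ns₁ ns₂ : ℕ → ℕ} (hns₁ : Tendsto ns₁ atTop atTop)
    (hns₂ : Tendsto ns₂ atTop atTop) (hq₁ : Tendsto (fun l => p (ns₁ l)) atTop (𝓝 q₁))
    (hq₂ : Tendsto (fun l => p (ns₂ l)) atTop (𝓝 q₂)) : q₁ = q₂ := by
  obtain ⟨l₁, hl₁⟩ := h.exists_tendsto_energy hw hconc hβ hs₁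
  obtain ⟨l₂, hl₂⟩ := h.exists_tendsto_energy hw hconc hβ hs₂
  -- Both energies refer to the same allocation, so their difference depends on the prices alone. It
  -- converges, and its values at the two limit points differ by `(n + 1) / β` times the squared
  -- distance of `q₁` and `q₂`.
  have hdiff : ∀ k, M.energy β (y k) (p k) xs q₁ - M.energy β (y k) (p k) xs q₂
      = ∑ j, (n + 1) / (2 * β) * ((q₁ j - p k j) ^ 2 - (q₂ j - p k j) ^ 2) := fun k => by
    simp only [energy, energyForm, ← Finset.sum_sub_distrib]
    exact Finset.sum_congr rfl fun j _ => by ring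
  have hlim : ∀ {ns : ℕ → ℕ} {r : Fin m → ℝ}, Tendsto ns atTop atTop →
      Tendsto (fun l => p (ns l)) atTop (𝓝 r) →
      l₁ - l₂ = ∑ j, (n + 1) / (2 * β) * ((q₁ j - r j) ^ 2 - (q₂ j - r j) ^ 2) := by
    intro ns r hns hr
    have h1 := (hl₁.sub hl₂).comp hns
    simp only [Function.comp_def, hdiff] at h1
    refine tendsto_nhds_unique h1 (tendsto_finsetSum _ fun j _ => ?_)
    have hj := tendsto_pi_nhds.1 hr j
    exact ((((tendsto_const_nhds.sub hj).pow 2).sub ((tendsto_const_nhds.sub hj).pow 2))).const_mul _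
  have h1 := hlim hns₁ hq₁
  rw [hlim hns₂ hq₂, ← sub_eq_zero, ← Finset.sum_sub_distrib] at h1
  have h2 : ∑ j, (n + 1) / β * (q₁ j - q₂ j) ^ 2 = 0 := by
    rw [← h1]
    exact Finset.sum_congr rfl fun j _ => by field_simp; ring
  rw [Finset.sum_eq_zero_iff_of_nonneg (fun j _ => by positivity)] at h2
  have hn : ((n : ℝ) + 1) / β ≠ 0 := by positivity
  exact funext fun j => by simpa [hn, sub_eq_zero, hβ.ne'] using h2 j (Finset.mem_univ j)

lemma exists_tendsto_price (hw : ∀ i, 0 < M.budget i)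
    (hconc : ∀ i, ConcaveOn ℝ (nonnegOrthant m) (M.utility i)) (hβ : 0 < β)
    (h : M.IsADMMRun β x y p) (hs : M.IsSaddlePoint q xs) :
    ∃ q', M.IsSaddlePoint q' xs ∧ Tendsto p atTop (𝓝 q') := by
  obtain ⟨P, hP, hbound⟩ := h.exists_abs_price_le hw hconc hβ hs
  have hmem : ∀ k, p k ∈ Metric.closedBall q P := fun k => by
    rw [Metric.mem_closedBall, dist_comm]
    exact (dist_pi_le_iff hP).2 fun j => hbound k j
  obtain ⟨q', -, φ, hφ, hq'⟩ := tendsto_subseq_of_bounded Metric.isBounded_closedBall hmem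
  have hs' := h.isSaddlePoint_of_tendsto hw hconc hβ hs hφ.tendsto_atTop hq'
  refine ⟨q', hs', tendsto_of_subseq_tendsto fun ns hns => ?_⟩
  obtain ⟨q'', -, ψ, hψ, hq''⟩ := tendsto_subseq_of_bounded (x := p ∘ ns)
    Metric.isBounded_closedBall fun k => hmem (ns k)
  have hnsψ := hns.comp hψ.tendsto_atTop
  have hs'' := h.isSaddlePoint_of_tendsto hw hconc hβ hs hnsψ hq''
  obtain rfl := h.price_limit_unique hw hconc hβ hs' hs'' hφ.tendsto_atTop hnsψ hq' hq''
  exact ⟨ψ, hq''⟩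

end IsADMMRun

/-! ### Averages of the iterates -/

lemma iterateMean_apply {ι : Type*} {E : ι → Type*} [∀ i, AddCommGroup (E i)]
    [∀ i, Module ℝ (E i)] (z : ℕ → ∀ i, E i) (K : ℕ) (i : ι) :
    iterateMean z K i = iterateMean (fun k => z k i) K := by
  simp [iterateMean, Finset.sum_apply]

lemma sum_iterateMean_sub_const {ι : Type*} (s : Finset ι) (z : ℕ → ι → ℝ) (c : ℝ) {K : ℕ}
    (hK : 1 ≤ K) :
    ∑ i ∈ s, iterateMean (fun k => z k i) K - c = iterateMean (fun k => ∑ i ∈ s, z k i - c) K := by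
  have hK' : (K : ℝ) ≠ 0 := by positivity
  simp only [iterateMean, smul_eq_mul, ← Finset.mul_sum, Finset.sum_sub_distrib]
  rw [Finset.sum_comm, Finset.sum_const, Finset.card_range, nsmul_eq_mul, mul_sub,
    inv_mul_cancel_left₀ hK']

lemma iterateMean_eq_sum {E : Type*} [AddCommGroup E] [Module ℝ E] (z : ℕ → E) (K : ℕ) :
    iterateMean z K = ∑ k ∈ Finset.range K, (K : ℝ)⁻¹ • z (k + 1) := Finset.smul_sum

lemma sum_range_inv {K : ℕ} (hK : 1 ≤ K) : ∑ _k ∈ Finset.range K, (K : ℝ)⁻¹ = 1 := by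
  have hK' : (K : ℝ) ≠ 0 := by positivity
  rw [Finset.sum_const, Finset.card_range, nsmul_eq_mul, mul_inv_cancel₀ hK']

lemma le_map_iterateMean {E : Type*} [AddCommGroup E] [Module ℝ E] {s : Set E} {f : E → ℝ}
    (hf : ConcaveOn ℝ s f) {z : ℕ → E} (hz : ∀ k, z (k + 1) ∈ s) {K : ℕ} (hK : 1 ≤ K) :
    iterateMean (fun k => f (z k)) K ≤ f (iterateMean z K) := by
  rw [iterateMean_eq_sum, iterateMean_eq_sum]
  exact hf.le_map_sum (fun _ _ => by positivity) (sum_range_inv hK) fun k _ => hz k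

lemma concaveOn_lagrangian_left (hw : ∀ i, 0 < M.budget i)
    (hconc : ∀ i, ConcaveOn ℝ (nonnegOrthant m) (M.utility i)) (r : Fin m → ℝ) :
    ConcaveOn ℝ {x | ∀ i, x i ∈ M.logDomain i} fun x => M.lagrangian x r := by
  have h := concaveOn_socialObjective hw hconc
  refine ⟨h.1, fun x hx z hz a b ha hb hab => ?_⟩
  have h1 := h.2 hx hz ha hb hab
  have h2 : ∑ j, r j * (∑ i, (a • x + b • z) i j - M.capacity j)
      = a * ∑ j, r j * (∑ i, x i j - M.capacity j)
        + b * ∑ j, r j * (∑ i, z i j - M.capacity j) := by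
    rw [Finset.mul_sum, Finset.mul_sum, ← Finset.sum_add_distrib]
    refine Finset.sum_congr rfl fun j _ => ?_
    simp only [Pi.add_apply, Pi.smul_apply, smul_eq_mul, Finset.sum_add_distrib, ← Finset.mul_sum]
    linear_combination r j * M.capacity j * hab
  simp only [lagrangian, smul_eq_mul] at h1 ⊢
  rw [h2]
  linarith

lemma concaveOn_lagrangian_right (z : Fin n → Fin m → ℝ) :
    ConcaveOn ℝ Set.univ fun q => -M.lagrangian z q := by
  refine ⟨convex_univ, fun q _ r _ a b _ _ hab => le_of_eq ?_⟩
  have h : ∑ j, (a • q + b • r) j * (∑ i, z i j - M.capacity j)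
      = a * ∑ j, q j * (∑ i, z i j - M.capacity j)
        + b * ∑ j, r j * (∑ i, z i j - M.capacity j) := by
    rw [Finset.mul_sum, Finset.mul_sum, ← Finset.sum_add_distrib]
    refine Finset.sum_congr rfl fun j _ => ?_
    simp only [Pi.add_apply, Pi.smul_apply, smul_eq_mul]
    ring
  simp only [lagrangian, smul_eq_mul]
  rw [h]
  linear_combination -M.socialObjective z * hab

lemma iterateMean_mem_logDomain (hconc : ∀ i, ConcaveOn ℝ (nonnegOrthant m) (M.utility i))
    {x : ℕ → Fin n → Fin m → ℝ} (hx : ∀ k i, x (k + 1) i ∈ M.logDomain i) {K : ℕ} (hK : 1 ≤ K)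
    (i : Fin n) : iterateMean x K i ∈ M.logDomain i := by
  rw [iterateMean_apply, iterateMean_eq_sum]
  exact (convex_logDomain hconc i).sum_mem (fun _ _ => by positivity) (sum_range_inv hK)
    fun k _ => hx k i

namespace IsADMMRun

variable {β : ℝ} {x y : ℕ → Fin n → Fin m → ℝ} {p : ℕ → Fin m → ℝ} {q : Fin m → ℝ}
  {xs : Fin n → Fin m → ℝ}

/-- The one-round gaps telescope to the initial energy. Jensen moves the means inside, the
Lagrangian being concave in the allocation and affine in the price. -/
lemma lagrangian_iterateMean_sub_le (hw : ∀ i, 0 < M.budget i)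
    (hconc : ∀ i, ConcaveOn ℝ (nonnegOrthant m) (M.utility i)) (hβ : 0 < β)
    (h : M.IsADMMRun β x y p) {K : ℕ} (hK : 1 ≤ K) {z : Fin n → Fin m → ℝ}
    (hz : ∀ i, z i ∈ M.logDomain i) (r : Fin m → ℝ) :
    M.lagrangian z (iterateMean p K) - M.lagrangian (iterateMean x K) r
      ≤ M.energy β (y 0) (p 0) z r / K := by
  have h1 := le_map_iterateMean (concaveOn_lagrangian_left hw hconc r)
    (fun k => (h k).mem_logDomain) hK
  have h2 := le_map_iterateMean (concaveOn_lagrangian_right (M := M) z) (z := p)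
    (fun _ => Set.mem_univ _) hK
  have h3 : ∑ k ∈ Finset.range K, (M.lagrangian z (p (k + 1)) - M.lagrangian (x (k + 1)) r)
      ≤ M.energy β (y 0) (p 0) z r := by
    have h4 : ∀ k, M.lagrangian z (p (k + 1)) - M.lagrangian (x (k + 1)) r
        ≤ M.energy β (y k) (p k) z r - M.energy β (y (k + 1)) (p (k + 1)) z r := fun k => by
      have h5 := (h k).lagrangian_gap hw hconc hβ hz r
      have h6 : 0 ≤ M.movement β (y k) (p k) (y (k + 1)) (p (k + 1)) := energyForm_nonneg hβ _ _ _
      linarith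
    refine (Finset.sum_le_sum fun k _ => h4 k).trans ?_
    rw [Finset.sum_range_sub' fun k => M.energy β (y k) (p k) z r]
    exact sub_le_self _ (energyForm_nonneg hβ _ _ _)
  have h4 := mul_le_mul_of_nonneg_left h3 (by positivity : 0 ≤ (K : ℝ)⁻¹)
  simp only [iterateMean, smul_eq_mul, Finset.sum_neg_distrib] at h1 h2
  rw [Finset.sum_sub_distrib, inv_mul_eq_div _ (M.energy β (y 0) (p 0) z r)] at h4
  simp only [iterateMean]
  linarith

/-- The excess is the price increment divided by `β`, so its mean telescopes; bounded prices then
give the `1 / K` rate of both constraint families. -/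
lemma iterateMean_excess (hβ : 0 < β) (h : M.IsADMMRun β x y p) (K : ℕ) (j : Fin m) :
    iterateMean (fun k => M.excess (y k) j) K = (p K j - p 0 j) / β / K := by
  have h1 : ∀ k, M.excess (y (k + 1)) j = (p (k + 1) j - p k j) / β := fun k => by
    rw [(h k).price_eq j]
    field_simp
    ring
  simp only [iterateMean, h1, smul_eq_mul]
  rw [← Finset.sum_div, Finset.sum_range_sub fun k => p k j, inv_mul_eq_div]

lemma excess_iterateMean (hβ : 0 < β) (h : M.IsADMMRun β x y p) {K : ℕ} (hK : 1 ≤ K)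
    (j : Fin m) : M.excess (iterateMean y K) j = (p K j - p 0 j) / β / K := by
  rw [← h.iterateMean_excess hβ, excess]
  simp only [iterateMean_apply]
  rw [sum_iterateMean_sub_const Finset.univ (fun k i => y k i j) _ hK]
  rfl

lemma excess_demand_iterateMean (hβ : 0 < β) (h : M.IsADMMRun β x y p) {K : ℕ} (hK : 1 ≤ K)
    (j : Fin m) :
    ∑ i, iterateMean x K i j - M.capacity j = (n + 1) * ((p K j - p 0 j) / β / K) := by
  rw [← h.iterateMean_excess hβ]
  simp only [iterateMean_apply]
  rw [sum_iterateMean_sub_const Finset.univ (fun k i => x k i j) _ hK]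
  simp only [iterateMean, (h _).excess_demand hβ, ← Finset.mul_sum, smul_eq_mul]
  ring

lemma demand_sub_baseline_iterateMean (hβ : 0 < β) (h : M.IsADMMRun β x y p) (K : ℕ) (i : Fin n)
    (j : Fin m) : iterateMean x K i j - iterateMean y K i j = (p K j - p 0 j) / β / K := by
  rw [← h.iterateMean_excess hβ]
  simp only [iterateMean_apply]
  simp only [iterateMean, (h _).demand_eq hβ, Finset.sum_add_distrib, smul_eq_mul]
  ring

lemma constraint_rate (hw : ∀ i, 0 < M.budget i)
    (hconc : ∀ i, ConcaveOn ℝ (nonnegOrthant m) (M.utility i)) (hβ : 0 < β)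
    (h : M.IsADMMRun β x y p) (hs : M.IsSaddlePoint q xs) :
    ∃ D : ℝ, 0 ≤ D ∧ ∀ (K : ℕ) (j : Fin m), |(p K j - p 0 j) / β / K| ≤ D / K := by
  obtain ⟨P, hP, hbound⟩ := h.exists_abs_price_le hw hconc hβ hs
  refine ⟨2 * P / β, by positivity, fun K j => ?_⟩
  rw [abs_div, abs_div, Nat.abs_cast, abs_of_pos hβ]
  gcongr
  calc |p K j - p 0 j| = |(q j - p 0 j) - (q j - p K j)| := by congr 1; ring
    _ ≤ |q j - p 0 j| + |q j - p K j| := abs_sub _ _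
    _ ≤ 2 * P := by linarith [hbound 0 j, hbound K j]

lemma primal_rate (hw : ∀ i, 0 < M.budget i)
    (hconc : ∀ i, ConcaveOn ℝ (nonnegOrthant m) (M.utility i)) (hβ : 0 < β)
    (h : M.IsADMMRun β x y p) (hs : M.IsSaddlePoint q xs) :
    ∃ C : ℝ, ∀ K : ℕ, 1 ≤ K →
      |M.socialObjective (iterateMean x K) - M.socialObjective xs| ≤ C / K ∧
      (∀ j, |∑ i, iterateMean y K i j - M.capacity j| ≤ C / K) ∧
      (∀ i j, |iterateMean x K i j - iterateMean y K i j| ≤ C / K) := by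
  obtain ⟨D, hD, hbound⟩ := h.constraint_rate hw hconc hβ hs
  -- At the reference price `0` the Lagrangian is the objective itself, so `E` controls how far the
  -- mean falls below the optimum. The reverse bound `F` is the value, at the prices `q`, of the
  -- capacity violation.
  set E := M.energy β (y 0) (p 0) xs 0 with hEdef
  have hE : 0 ≤ E := energyForm_nonneg hβ _ _ _
  set F := ∑ j, |q j| * ((n + 1) * D) with hFdef
  have hF : 0 ≤ F := by positivity
  refine ⟨D + E + F, fun K hK => ?_⟩
  have hDle : D / K ≤ (D + E + F) / K := by gcongr; linarith
  refine ⟨abs_le.2 ⟨?_, ?_⟩, fun j => ?_, fun i j => ?_⟩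
  · have h1 := h.lagrangian_iterateMean_sub_le hw hconc hβ hK hs.1 0
    rw [lagrangian_eq_socialObjective hs.2.1] at h1
    have h2 : M.lagrangian (iterateMean x K) 0 = M.socialObjective (iterateMean x K) := by
      simp [lagrangian]
    have h3 : E / K ≤ (D + E + F) / K := by gcongr; linarith
    linarith
  · have h1 := hs.2.2 _
      (iterateMean_mem_logDomain hconc (fun k => (h k).mem_logDomain) hK)
    rw [lagrangian] at h1
    have h2 : ∑ j, q j * (∑ i, iterateMean x K i j - M.capacity j) ≤ F / K := by
      rw [hFdef, Finset.sum_div]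
      refine Finset.sum_le_sum fun j _ => (le_abs_self _).trans ?_
      rw [h.excess_demand_iterateMean hβ hK j, abs_mul, abs_mul,
        abs_of_nonneg (by positivity : (0 : ℝ) ≤ n + 1), mul_div_assoc, mul_div_assoc]
      gcongr
      exact hbound K j
    have h3 : F / K ≤ (D + E + F) / K := by gcongr; linarith
    linarith
  · exact (h.excess_iterateMean hβ hK j ▸ (hbound K j).trans hDle :
      |M.excess (iterateMean y K) j| ≤ (D + E + F) / K)
  · rw [h.demand_sub_baseline_iterateMean hβ K i j]
    exact (hbound K j).trans hDle

lemma lagrangian_rate (hw : ∀ i, 0 < M.budget i)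
    (hconc : ∀ i, ConcaveOn ℝ (nonnegOrthant m) (M.utility i)) (hβ : 0 < β)
    (h : M.IsADMMRun β x y p) (R : ℝ) :
    ∃ C : ℝ, ∀ K : ℕ, 1 ≤ K →
      ∀ (z : Fin n → Fin m → ℝ) (r : Fin m → ℝ), (∀ i, z i ∈ M.logDomain i) →
        (∀ i j, |z i j| ≤ R) → (∀ j, |r j| ≤ R) →
          M.lagrangian z (iterateMean p K) - M.lagrangian (iterateMean x K) r ≤ C / K := by
  -- A bound for the initial energy, uniform in `z` and `r`, from `(a - b)² ≤ 2 (a² + b²)`.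
  refine ⟨∑ j, ((n + 1) / (2 * β) * (2 * (R ^ 2 + p 0 j ^ 2))
    + β / 2 * ∑ i, 2 * (R ^ 2 + y 0 i j ^ 2) + β / 2 * M.excess (y 0) j ^ 2),
    fun K hK z r hz hzR hrR => (h.lagrangian_iterateMean_sub_le hw hconc hβ hK hz r).trans ?_⟩
  have hsq : ∀ {a b : ℝ}, |a| ≤ R → (a - b) ^ 2 ≤ 2 * (R ^ 2 + b ^ 2) := fun {a b} ha => by
    have h1 : a ^ 2 ≤ R ^ 2 := sq_le_sq' (abs_le.1 ha).1 (abs_le.1 ha).2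
    linarith [sq_nonneg (a + b), (by ring : (a - b) ^ 2 + (a + b) ^ 2 = 2 * (a ^ 2 + b ^ 2))]
  simp only [energy, energyForm]
  gcongr with j _ i _
  · exact hsq (hrR j)
  · exact hsq (hzR i j)

lemma price_update_rate (hw : ∀ i, 0 < M.budget i)
    (hconc : ∀ i, ConcaveOn ℝ (nonnegOrthant m) (M.utility i)) (hβ : 0 < β)
    (h : M.IsADMMRun β x y p) (hs : M.IsSaddlePoint q xs) :
    ∃ C : ℝ, ∀ k : ℕ, 1 ≤ k → ∑ j, (p (k + 1) j - p k j) ^ 2 ≤ C / k := by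
  refine ⟨2 * β * M.energy β (y 0) (p 0) xs q, fun k hk => ?_⟩
  have hE : 0 ≤ M.energy β (y 0) (p 0) xs q := energyForm_nonneg hβ _ _ _
  have hk' : (0 : ℝ) < k := by positivity
  calc ∑ j, (p (k + 1) j - p k j) ^ 2
      ≤ 2 * β * M.movement β (y k) (p k) (y (k + 1)) (p (k + 1)) :=
        sum_sq_le_energyForm hβ _ (fun i j => y (k + 1) i j - y k i j)
          (fun j => M.excess (y (k + 1)) j - M.excess (y k) j)
    _ ≤ 2 * β * (M.energy β (y 0) (p 0) xs q / k) := by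
        gcongr
        refine (h.movement_le_div hw hconc hβ hs k).trans ?_
        gcongr
        linarith
    _ = 2 * β * M.energy β (y 0) (p 0) xs q / k := by rw [mul_div_assoc]

end IsADMMRun

end FisherMarket

theorem mainTheorem2 {n m : ℕ} (M : FisherMarket n m)
    (hhom : M.HasHomogeneousConstraints)
    (hw : ∀ i, 0 < M.budget i)
    (hconc : ∀ i, ConcaveOn ℝ (nonnegOrthant m) (M.utility i))
    (hdeg : ∀ i, IsHomogeneousDegreeOne (M.utility i))
    (hpos : ∀ i, ∃ x ∈ M.admissible i, 0 < M.utility i x)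
    (heq : ∃ p, M.IsEquilibriumPrice p)
    (β : ℝ) (hβ : 0 < β) :
    -- for continuous utilities every round of the algorithm is well defined
    ((∀ i, ContinuousOn (M.utility i) (nonnegOrthant m)) →
      ∀ (y : Fin n → Fin m → ℝ) (p : Fin m → ℝ),
        ∃! z : (Fin n → Fin m → ℝ) × (Fin n → Fin m → ℝ) × (Fin m → ℝ),
          M.IsADMMStep β y p z.1 z.2.1 z.2.2) ∧
    -- convergence of every run, from arbitrary initial data
    ∀ (x y : ℕ → Fin n → Fin m → ℝ) (p : ℕ → Fin m → ℝ), M.IsADMMRun β x y p →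
      ∃ (pstar : Fin m → ℝ) (xstar : Fin n → Fin m → ℝ),
        M.IsEquilibrium pstar xstar ∧ M.IsSocialOptimum xstar xstar ∧
        Tendsto p atTop (𝓝 pstar) ∧
        -- rate for the objective and for both families of constraints
        (∃ C : ℝ, ∀ K : ℕ, 1 ≤ K →
          |M.socialObjective (iterateMean x K) - M.socialObjective xstar| ≤ C / K ∧
          (∀ j, |∑ i, iterateMean y K i j - M.capacity j| ≤ C / K) ∧
          (∀ i j, |iterateMean x K i j - iterateMean y K i j| ≤ C / K)) ∧
        -- rate for allocations and prices together, as a saddle point of the Lagrangian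
        (∀ R : ℝ, ∃ C : ℝ, ∀ K : ℕ, 1 ≤ K →
          ∀ (z : Fin n → Fin m → ℝ) (r : Fin m → ℝ), (∀ i, z i ∈ M.logDomain i) →
            (∀ i j, |z i j| ≤ R) → (∀ j, |r j| ≤ R) →
              M.lagrangian z (iterateMean p K) - M.lagrangian (iterateMean x K) r ≤ C / K) ∧
        -- rate for the last price update
        (∃ C : ℝ, ∀ k : ℕ, 1 ≤ k → ∑ j, (p (k + 1) j - p k j) ^ 2 ≤ C / k) := by
  refine ⟨fun hcont y p => FisherMarket.existsUnique_admmStep hw hconc hdeg hpos hcont hβ y p,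
    fun x y p hrun => ?_⟩
  obtain ⟨pe, xe, he⟩ := heq
  obtain ⟨q, hq, hlim⟩ := hrun.exists_tendsto_price hw hconc hβ
    (he.isSaddlePoint hhom hw hdeg hpos)
  -- The run determines only the price: the limit price supports the allocation of any given
  -- equilibrium.
  exact ⟨q, xe, hq.isEquilibrium hhom hw hdeg, hq.isSocialOptimum, hlim,
    hrun.primal_rate hw hconc hβ hq, hrun.lagrangian_rate hw hconc hβ,
    hrun.price_update_rate hw hconc hβ hq⟩
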